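/- Let $D$ be a (planar) diagram of an oriented singular link $L$, with finite set $c^\sharp(D)$ of double points, let $b\in c^\sharp(D)$, and let $D_+$ and $D_-$ be the diagrams, of (possibly singular) links $L_+$ and $L_-$, obtained from $D$ by resolving $b$ to a positive and to a negative crossing respectively. Conventions. Let $A=\mathbb F_2[x]/(x^2)$ with $\Delta(1)=x\otimes 1+1\otimes x$, $\Delta(x)=x\otimes x$, $\deg 1=1$, $\deg x=-1$. For a diagram $E$ without double points, with $n_+$ positive and $n_-$ negative crossings, $C^{i,j}(E)$ denotes its Khovanov complex over $\mathbb F_2$: it has as basis the enhanced states, i.e. pairs of a set $s$ of crossings (those that are 1-smoothed; the oriented smoothing is the 0-smoothing of a positive and the 1-smoothing of a negative crossing) and a labelling of the circles of the smoothed diagram by $1,x$, with $i=|s|-n_-$ and $j=\#\{1\}-\#\{x\}+|s|+n_+-2n_-$; its differential is the sum of the saddle maps (multiplication or comultiplication of $A$) from the 0- to the 1-smoothing of one crossing. If a negative crossing $c$ of $E$ is changed to a positive one, giving $E'$, the genus-1 map $\widehat\Phi_c:C(E)\to C(E')$ is zero on states with $c\notin s$, and on states with $c\in s$ it goes to the state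 $s\setminus\{c\}$ of $E'$ (the same smoothed diagram) by the genus-1 cobordism at $c$, i.e. the saddle to the other smoothing of $c$ followed by the saddle back. For $S\subset c^\sharp(D)$ let $D_S$ be the diagram in which the double points in $S$ are made positive crossings and the others negative crossings. Then $C(D;\mathbb F_2)$ is the multiple mapping cone of the cube $(\{C(D_S)\}_S,\{\widehat\Phi_c\}_c)$: $$C^{i,j}(D;\mathbb F_2)=\bigoplus_{S\subset c^\sharp(D)}C^{\,i+|c^\sharp(D)\setminus S|,\,j}(D_S),$$ with differential the sum of the differentials of the $C(D_S)$ and the maps $\widehat\Phi_c:C(D_S)\to C(D_{S\cup\{c\}})$, $c\in c^\sharp(D)\setminus S$. Put $Kh^{i,j}(L;\mathbb F_2)=Kh^{i,j}(D;\mathbb F_2)=H^i(C^{*,j}(D;\mathbb F_2))$, and likewise for $L_\pm$ with $D_\pm$. Theorem. $C(D;\mathbb F_2)$, $C(D_-;\mathbb F_2)$ and $C(D_+;\mathbb F_2)$ are complexes (the differential squares to zero and has bidegree $(1,0)$); the genus-1 maps $\widehat\Phi_b:C((D_-)_S)\to C((D_+)_S)$, for $S\subset c^\sharp(D)\setminus\{b\}$,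 form a chain map $\widehat\Phi:C(D_-;\mathbb F_2)\to C(D_+;\mathbb F_2)$ of bidegree $(0,0)$; and for each $j\in\mathbb Z$ there is a long exact sequence of $\mathbb F_2$-vector spaces $$\cdots\to Kh^{i-1,j}(L;\mathbb F_2)\to Kh^{i,j}(L_-;\mathbb F_2)\xrightarrow{\ \widehat\Phi_*\ }Kh^{i,j}(L_+;\mathbb F_2)\to Kh^{i,j}(L;\mathbb F_2)\to\cdots$$ in which the middle map is induced by $\widehat\Phi$. -/

import Mathlib

noncomputable section

/-! ## Oriented singular link diagrams

Turn a vertex of an oriented (singular) link diagram so that both strands point upwards. Then it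
has two incoming ends, at the lower left and at the lower right, and two outgoing ends, at the
upper left and at the upper right; the two strands run from lower left to upper right and from
lower right to upper left. Every arc that is not a closed loop runs from an outgoing end of a
vertex to an incoming end of a vertex. -/

/-- The left or the right end at the bottom (or at the top) of a vertex. -/
inductive Side where
  | left
  | right
  deriving DecidableEq

instance : Fintype Side := ⟨{Side.left, Side.right}, by rintro (_ | _) <;> simp⟩

/-- The underlying oriented 4-valent graph of a link diagram, with the cyclic order of the ends at
each vertex: the arc that leaves `v` at the end `a` arrives at the end `next (v, a)`. In addition
there are `loops` closed components without vertices. -/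
structure OrientedGraph (V : Type*) where
  next : V × Side ≃ V × Side
  loops : ℕ

namespace OrientedGraph

variable {V : Type*} (Γ : OrientedGraph V)

/-- The ends of the arcs at the vertices: `inl (v, a)` is outgoing, `inr (v, a)` is incoming. -/
abbrev Dart (V : Type*) : Type _ := (V × Side) ⊕ (V × Side)

/-- The next end at the same vertex, counterclockwise. -/
def rotate : Dart V → Dart V
  | Sum.inl (v, Side.right) => Sum.inl (v, Side.left)
  | Sum.inl (v, Side.left) => Sum.inr (v, Side.left)
  | Sum.inr (v, Side.left) => Sum.inr (v, Side.right)
  | Sum.inr (v, Side.right) => Sum.inl (v, Side.right)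

/-- The other end of the same arc. -/
def opposite : Dart V → Dart V
  | Sum.inl e => Sum.inr (Γ.next e)
  | Sum.inr e => Sum.inl (Γ.next.symm e)

/-- The faces of the ribbon surface of the graph: walk along an arc, then turn to the next end. -/
abbrev Face : Type _ := Quot fun d d' : Dart V => d' = rotate (Γ.opposite d)

/-- The connected components of the graph (without the loops). -/
abbrev Component : Type _ := Quot fun v w : V => ∃ a a', Γ.next (v, a) = (w, a')

/-- The graph, with its cyclic orders, is drawn in the plane (equivalently on the sphere): each
component has Euler characteristic 2. Since `V - E + F ≤ 2` holds for each component, it is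
enough to ask this of the sum. The arcs are indexed by the ends where they start. -/
def IsPlanar : Prop :=
  (Nat.card V : ℤ) - Nat.card (V × Side) + Nat.card Γ.Face = 2 * Nat.card Γ.Component

/-- The arcs, indexed by the ends where they start, and the closed loops. -/
abbrev Arc : Type _ := (V × Side) ⊕ Fin Γ.loops

/-- The arc that leaves `v` at the upper end `a`. -/
def outArc (v : V) (a : Side) : Γ.Arc := Sum.inl (v, a)

/-- The arc that enters `v` at the lower end `a`. -/
def inArc (v : V) (a : Side) : Γ.Arc := Sum.inl (Γ.next.symm (v, a))

/-- The two arcs are joined at a vertex, if the vertices are smoothed according to `σ`. The value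
`true` is the oriented smoothing `)(`, which joins lower left to upper left and lower right to
upper right; `false` is the other smoothing, which joins the two lower ends to each other and the
two upper ends to each other. -/
def Joined (σ : V → Bool) (α β : Γ.Arc) : Prop :=
  ∃ v,
    (σ v = true ∧ ∃ a, α = Γ.inArc v a ∧ β = Γ.outArc v a) ∨
    (σ v = false ∧ ((α = Γ.inArc v Side.left ∧ β = Γ.inArc v Side.right) ∨
      (α = Γ.outArc v Side.left ∧ β = Γ.outArc v Side.right)))

/-- The connected components of the closed 1-manifold obtained by smoothing along `σ`. -/
abbrev Circle (σ : V → Bool) : Type _ := Quot (Γ.Joined σ)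

/-- The component that contains an arc. -/
def circleOf (σ : V → Bool) (α : Γ.Arc) : Γ.Circle σ := Quot.mk _ α

/-- The component of one of the two pieces of the smoothing at `v` (the left or the upper one). -/
def circle₁ (σ : V → Bool) (v : V) : Γ.Circle σ := Γ.circleOf σ (Γ.outArc v Side.left)

/-- The component of the other piece of the smoothing at `v` (the right or the lower one). -/
def circle₂ (σ : V → Bool) (v : V) : Γ.Circle σ :=
  Γ.circleOf σ (if σ v = true then Γ.outArc v Side.right else Γ.inArc v Side.left)

end OrientedGraph

/-- The kinds of vertices in a diagram of an oriented singular link. At a positive crossing the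
strand from lower left to upper right is the upper one, at a negative crossing the lower one. -/
inductive VertexKind where
  | positive
  | negative
  | double
  deriving DecidableEq

/-- A diagram of an oriented singular link, whose crossings and double points are indexed by `V`. -/
structure SingularLinkDiagram (V : Type*) where
  graph : OrientedGraph V
  planar : graph.IsPlanar
  kind : V → VertexKind

/-! ## The Frobenius algebra `A = 𝔽₂[x]/(x²)` and its TQFT on saddles -/

/-- The basis `1`, `x` of `A`. -/
inductive Label where
  | one
  | x
  deriving DecidableEq

instance : Fintype Label := ⟨{Label.one, Label.x}, by rintro (_ | _) <;> simp⟩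

namespace Label

/-- `deg 1 = 1` and `deg x = -1`. -/
def deg : Label → ℤ
  | one => 1
  | x => -1

/-- The coefficient of `r` in the product `p q`. -/
def mulCoeff : (p q r : Label) → ZMod 2
  | one, one, one => 1
  | one, x, x => 1
  | x, one, x => 1
  | _, _, _ => 0

/-- The coefficient of `q ⊗ r` in `Δ p`, where `Δ 1 = x ⊗ 1 + 1 ⊗ x` and `Δ x = x ⊗ x`. -/
def comulCoeff : (p q r : Label) → ZMod 2
  | one, x, one => 1
  | one, one, x => 1
  | x, x, x => 1
  | _, _, _ => 0

end Label

namespace OrientedGraph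

variable {V : Type*} (Γ : OrientedGraph V)

/-- The basis of `Z_A` of the smoothing along `σ`, the tensor power of `A` over its components. -/
abbrev Labeling (σ : V → Bool) : Type _ := Γ.Circle σ → Label

instance [Finite V] (σ : V → Bool) : Fintype (Γ.Circle σ) := Fintype.ofFinite _

instance [Finite V] (σ : V → Bool) : Fintype (Γ.Labeling σ) := Fintype.ofFinite _

open Classical in
/-- The matrix coefficient of `Z_A` of the saddle at `v`, from the smoothing along `σ` to the
smoothing along `σ'`, where `σ'` differs from `σ` exactly at `v`: the labels on the components that
do not meet `v` are kept; two different components at `v` are merged by the multiplication, and one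
component is split by the comultiplication. (In the plane one of these two cases holds.) -/
def saddleCoeff (v : V) (σ σ' : V → Bool) (ρ : Γ.Labeling σ) (ρ' : Γ.Labeling σ') : ZMod 2 :=
  if ∀ α : Γ.Arc, Γ.circleOf σ α ≠ Γ.circle₁ σ v → Γ.circleOf σ α ≠ Γ.circle₂ σ v →
      ρ' (Γ.circleOf σ' α) = ρ (Γ.circleOf σ α) then
    if Γ.circle₁ σ v ≠ Γ.circle₂ σ v ∧ Γ.circle₁ σ' v = Γ.circle₂ σ' v then
      Label.mulCoeff (ρ (Γ.circle₁ σ v)) (ρ (Γ.circle₂ σ v)) (ρ' (Γ.circle₁ σ' v))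
    else if Γ.circle₁ σ v = Γ.circle₂ σ v ∧ Γ.circle₁ σ' v ≠ Γ.circle₂ σ' v then
      Label.comulCoeff (ρ (Γ.circle₁ σ v)) (ρ' (Γ.circle₁ σ' v)) (ρ' (Γ.circle₂ σ' v))
    else 0
  else 0

variable [DecidableEq V]

/-- Change the smoothing at `v`. -/
def flip (σ : V → Bool) (v : V) : V → Bool := Function.update σ v (!σ v)

/-- The matrix coefficient of `Z_A` of the genus-one cobordism at `v` from the smoothing along `σ`
to itself (`σ'` is equal to `σ`): a saddle to the other smoothing of `v`, then a saddle back. -/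
def genusCoeff [Finite V] (v : V) (σ σ' : V → Bool) (ρ : Γ.Labeling σ) (ρ' : Γ.Labeling σ') :
    ZMod 2 :=
  ∑ τ : Γ.Labeling (flip σ v),
    Γ.saddleCoeff v σ (flip σ v) ρ τ * Γ.saddleCoeff v (flip σ v) σ' τ ρ'

/-! ## Ordinary diagrams: enhanced states, the Khovanov differential, the genus-one map

An ordinary diagram is a graph `Γ` with signs `ε`; `ε v = true` says that `v` is positive. -/

/-- The smoothing of a diagram with signs `ε` along the state `s`: the 0-smoothing is made outside
`s` and the 1-smoothing in `s`. The oriented smoothing is the 0-smoothing of a positive crossing and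
the 1-smoothing of a negative crossing. -/
def smoothing (ε : V → Bool) (s : Finset V) (v : V) : Bool := xor (ε v) (decide (v ∈ s))

/-- Enhanced states of the diagram with signs `ε`. -/
structure EnhancedState (ε : V → Bool) where
  state : Finset V
  label : Γ.Labeling (smoothing ε state)

variable {Γ} in
/-- The degree of an enhanced state: the number of labels `1` minus the number of labels `x`. -/
def EnhancedState.deg [Finite V] {ε : V → Bool} (e : Γ.EnhancedState ε) : ℤ :=
  ∑ α, (e.label α).deg

instance [Finite V] (ε : V → Bool) : Finite (Γ.EnhancedState ε) :=
  Finite.of_injective (β := Σ s : Finset V, Γ.Labeling (smoothing ε s))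
    (fun e => ⟨e.state, e.label⟩) (by rintro ⟨s, l⟩ ⟨s', l'⟩ h; simpa using h)

variable {Γ} [Fintype V]

/-- The matrix coefficient of the differential `∑ δ_c` of the Khovanov complex over `𝔽₂` (so that
there are no signs) of one diagram (`ε'` is equal to `ε`). -/
def diffCoeff {ε ε' : V → Bool} (e : Γ.EnhancedState ε) (e' : Γ.EnhancedState ε') : ZMod 2 :=
  ∑ c ∈ Finset.univ \ e.state,
    if e'.state = insert c e.state then
      Γ.saddleCoeff c (smoothing ε e.state) (smoothing ε' e'.state) e.label e'.label
    else 0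

/-- The matrix coefficient of the genus-one map at `b`, from a diagram with a negative crossing `b`
to the diagram where `b` is made positive: it is zero on the 0-smoothing of the negative crossing,
and it is the genus-one cobordism from its 1-smoothing to the 0-smoothing of the positive crossing
(both are the oriented smoothing). -/
def genusMapCoeff (b : V) {ε ε' : V → Bool} (e : Γ.EnhancedState ε) (e' : Γ.EnhancedState ε') :
    ZMod 2 :=
  if b ∈ e.state ∧ e'.state = e.state.erase b then
    Γ.genusCoeff b (smoothing ε e.state) (smoothing ε' e'.state) e.label e'.label
  else 0

end OrientedGraph

/-! ## Khovanov homology of singular link diagrams -/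

namespace SingularLinkDiagram

variable {V : Type*} [DecidableEq V] (D : SingularLinkDiagram V)

/-- Replace the vertex `b` by a vertex of the kind `k`. -/
def resolve (b : V) (k : VertexKind) : SingularLinkDiagram V :=
  { D with kind := Function.update D.kind b k }

/-- The signs of the ordinary diagram `D_S`: double points in `S` are made positive crossings, the
other double points negative crossings. -/
def sign (S : Finset V) (v : V) : Bool :=
  match D.kind v with
  | VertexKind.positive => true
  | VertexKind.negative => false
  | VertexKind.double => decide (v ∈ S)

variable [Fintype V]

/-- The double points. -/
def doublePoints : Finset V := Finset.univ.filter fun v => D.kind v = VertexKind.double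

/-- The basis of the Khovanov complex of `D`, which is the multiple mapping cone of the cube of the
Khovanov complexes of the diagrams `D_S`: an enhanced state of `D_S` for a set `S` of double
points. -/
structure Generator where
  S : Finset V
  subset : S ⊆ D.doublePoints
  enh : D.graph.EnhancedState (D.sign S)

instance : Finite D.Generator :=
  Finite.of_injective (β := Σ S : Finset V, D.graph.EnhancedState (D.sign S))
    (fun g => ⟨g.S, g.enh⟩) (by rintro ⟨S, h, e⟩ ⟨S', h', e'⟩ hh; simpa using hh)

instance : Fintype D.Generator := Fintype.ofFinite _

/-- The number of positive crossings of `D_S`. -/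
def nPos (S : Finset V) : ℕ := (Finset.univ.filter fun v => D.sign S v = true).card

/-- The number of negative crossings of `D_S`. -/
def nNeg (S : Finset V) : ℕ := (Finset.univ.filter fun v => D.sign S v = false).card

variable {D} in
/-- The homological degree: the one in the Khovanov complex of `D_S`, shifted down by the number of
double points outside `S` in the multiple mapping cone. -/
def Generator.hdeg (g : D.Generator) : ℤ :=
  (g.enh.state.card : ℤ) - D.nNeg g.S - (D.doublePoints \ g.S).card

variable {D} in
/-- The quantum degree. -/
def Generator.qdeg (g : D.Generator) : ℤ :=
  g.enh.deg + g.enh.state.card + D.nPos g.S - 2 * D.nNeg g.S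

/-- The Khovanov complex of `D` over `𝔽₂`, as the sum over all bidegrees. -/
abbrev Chain : Type _ := D.Generator → ZMod 2

/-- The part of bidegree `(i, j)`. -/
def chain (i j : ℤ) : Submodule (ZMod 2) D.Chain where
  carrier := {f | ∀ g, f g ≠ 0 → g.hdeg = i ∧ g.qdeg = j}
  zero_mem' := fun _ h => absurd rfl h
  add_mem' := by
    intro f f' hf hf' g hg
    by_cases h : f g = 0
    · exact hf' g fun h' => hg (by simp [h, h'])
    · exact hf g h
  smul_mem' := by
    intro c f hf g hg
    exact hf g fun h => hg (by simp [h])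

/-- The matrix coefficient of the differential of the multiple mapping cone: the differential of
the Khovanov complex of `D_S`, plus the genus-one maps from `D_S` to `D_{S ∪ {b}}`. (There are no
signs over `𝔽₂`, and the order of the double points does not matter.) -/
def dCoeff (g g' : D.Generator) : ZMod 2 :=
  (if g'.S = g.S then OrientedGraph.diffCoeff g.enh g'.enh else 0) +
    ∑ b ∈ D.doublePoints \ g.S,
      if g'.S = insert b g.S then OrientedGraph.genusMapCoeff b g.enh g'.enh else 0

/-- The differential of the Khovanov complex. -/
def d : D.Chain →ₗ[ZMod 2] D.Chain :=
  Matrix.mulVecLin (Matrix.of fun g' g => D.dCoeff g g')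

/-- The Khovanov chains with the map `d` form a complex for each quantum degree. -/
def IsComplex : Prop :=
  D.d ∘ₗ D.d = 0 ∧ ∀ i j, (D.chain i j).map D.d ≤ D.chain (i + 1) j

/-- The cocycles of bidegree `(i, j)`. -/
def cocycles (i j : ℤ) : Submodule (ZMod 2) D.Chain := LinearMap.ker D.d ⊓ D.chain i j

/-- The coboundaries of bidegree `(i, j)`. -/
def coboundaries (i j : ℤ) : Submodule (ZMod 2) D.Chain := (D.chain (i - 1) j).map D.d

/-- The Khovanov homology `Kh^{i,j}(D; 𝔽₂)`. -/
abbrev Kh (i j : ℤ) : Type _ :=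
  D.cocycles i j ⧸ (D.coboundaries i j).submoduleOf (D.cocycles i j)

variable {D} in
/-- The homology class of a cocycle. -/
def homologyClass {i j : ℤ} (z : D.cocycles i j) : D.Kh i j := Submodule.Quotient.mk z

/-- The genus-one map at the vertex `b`, from the Khovanov complex of the diagram `D_-`, where `b`
is a negative crossing, to the one of `D_+`, where `b` is a positive crossing. On the summands for a
set `S` of the other double points it is the genus-one map at `b` of ordinary diagrams. -/
def genusMap (b : V) :
    (D.resolve b VertexKind.negative).Chain →ₗ[ZMod 2] (D.resolve b VertexKind.positive).Chain :=
  Matrix.mulVecLin (Matrix.of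
    fun (g' : (D.resolve b VertexKind.positive).Generator)
        (g : (D.resolve b VertexKind.negative).Generator) =>
      if g'.S = g.S then OrientedGraph.genusMapCoeff (Γ := D.graph) b g.enh g'.enh else 0)

end SingularLinkDiagram

end

noncomputable section

/-! ## How the circles change at a saddle -/

/-! Two facts carry the theorem: the differential squares to zero, and the complex of `D` is, up to
a shift, the mapping cone of the genus-one map.

At a double point the local picture is a chain of four smoothings: the 0-smoothing of the negative
crossing, the oriented smoothing, the oriented smoothing again (now of the positive crossing), and
the 1-smoothing of the positive crossing. The maps between them are a saddle, the genus-one map and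
a saddle. At an ordinary crossing there is a single saddle. The differential is thus a sum of one
`move` per vertex. Over 𝔽₂ its square vanishes once each move squares to zero and moves at distinct
vertices commute (`totalMove_totalMove`). Since the genus-one map is a composite of two saddles,
both properties reduce to saddles: those at distinct vertices commute (`saddle_comm`), and three in
a row at one vertex compose to zero (`saddle_saddle_saddle`).

These identities need no enumeration of labelings. Multiplications by `x` on the circles make `Z_A`
of a smoothing a cyclic module generated by its unit, and saddles respect them (`saddle_mulX`), so
it suffices to compare values on the unit (`linearMap_ext_unit`). A merging saddle sends the unit to
the unit; any other saddle sends it to `x + x'` for the two circles at the vertex, which is zero if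
they coincide (`saddle_unit`). Three saddles then give `(x + x')² = 2xx' = 0` or `2x = 0`. The two
orders of saddles at `v` and `w` can differ only if the change at one vertex alters whether the two
pieces at the other lie on one circle. In that case both vertices touch the same two circles in one
of the smoothings, and the resulting products agree or vanish.

Sorting generators by whether `b ∈ S` makes the differential of `D` block triangular, with the
differentials of the two resolutions on the diagonal and the genus-one map off it (`chainEquiv_d`).
The chain map property is then read off from `d² = 0` on the cone, and the exact sequence is that of
a cone (`exists_longExact_of_cone`). -/

theorem Side.sum_eq {M : Type*} [AddCommMonoid M] (f : Side → M) :
    ∑ a, f a = f Side.left + f Side.right :=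
  Finset.sum_pair (by decide)

namespace OrientedGraph

section Circles

variable {V : Type*} (Γ : OrientedGraph V)

/-- An arc on the second piece of the smoothing at `v`, which is oriented or not according to `o`;
the arc `Γ.outArc v Side.left` lies on the first piece. -/
def secondArc (o : Bool) (v : V) : Γ.Arc :=
  if o = true then Γ.outArc v Side.right else Γ.inArc v Side.left

theorem circle₁_eq (σ : V → Bool) (v : V) :
    Γ.circle₁ σ v = Γ.circleOf σ (Γ.outArc v Side.left) := rfl

theorem circle₂_eq (σ : V → Bool) (v : V) :
    Γ.circle₂ σ v = Γ.circleOf σ (Γ.secondArc (σ v) v) := rfl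

variable {Γ}

theorem circleOf_surjective (σ : V → Bool) : Function.Surjective (Γ.circleOf σ) :=
  Quot.mk_surjective

theorem circleOf_in_eq_out {σ : V → Bool} {v : V} (h : σ v = true) (a : Side) :
    Γ.circleOf σ (Γ.inArc v a) = Γ.circleOf σ (Γ.outArc v a) :=
  Quot.sound ⟨v, Or.inl ⟨h, a, rfl, rfl⟩⟩

theorem circleOf_in_eq_in {σ : V → Bool} {v : V} (h : σ v = false) :
    Γ.circleOf σ (Γ.inArc v Side.left) = Γ.circleOf σ (Γ.inArc v Side.right) :=
  Quot.sound ⟨v, Or.inr ⟨h, Or.inl ⟨rfl, rfl⟩⟩⟩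

theorem circleOf_out_eq_out {σ : V → Bool} {v : V} (h : σ v = false) :
    Γ.circleOf σ (Γ.outArc v Side.left) = Γ.circleOf σ (Γ.outArc v Side.right) :=
  Quot.sound ⟨v, Or.inr ⟨h, Or.inr ⟨rfl, rfl⟩⟩⟩

/-- A function on arcs that is compatible with the smoothing is constant on circles. -/
theorem eq_of_circleOf_eq {X : Type*} {σ : V → Bool} (h : Γ.Arc → X)
    (hin : ∀ w, σ w = true → ∀ a, h (Γ.inArc w a) = h (Γ.outArc w a))
    (hout : ∀ w, σ w = false → h (Γ.inArc w Side.left) = h (Γ.inArc w Side.right) ∧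
      h (Γ.outArc w Side.left) = h (Γ.outArc w Side.right))
    {α β : Γ.Arc} (e : Γ.circleOf σ α = Γ.circleOf σ β) : h α = h β := by
  have key : ∀ α β, Γ.Joined σ α β → h α = h β := by
    rintro α β ⟨w, ⟨hw, a, rfl, rfl⟩ | ⟨hw, ⟨rfl, rfl⟩ | ⟨rfl, rfl⟩⟩⟩
    · exact hin w hw a
    · exact (hout w hw).1
    · exact (hout w hw).2
  exact congrArg (Quot.lift h key) e

/-- If the two pieces of the smoothing at `v` lie on one circle, then so do all arcs at `v`. -/
theorem circleOf_eq_circle₁ {σ : V → Bool} {v : V} (h : Γ.circle₁ σ v = Γ.circle₂ σ v) :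
    (∀ a, Γ.circleOf σ (Γ.inArc v a) = Γ.circle₁ σ v) ∧
      ∀ a, Γ.circleOf σ (Γ.outArc v a) = Γ.circle₁ σ v := by
  rw [circle₁_eq, circle₂_eq, secondArc] at h
  rw [circle₁_eq]
  cases hv : σ v
  · have h1 := circleOf_in_eq_in (Γ := Γ) hv
    have h2 := circleOf_out_eq_out (Γ := Γ) hv
    simp only [hv, Bool.false_eq_true, if_false] at h
    exact ⟨by rintro (_ | _) <;> simp [h, ← h1], by rintro (_ | _) <;> simp [h2]⟩
  · have h1 := circleOf_in_eq_out (Γ := Γ) hv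
    simp only [hv, if_true] at h
    exact ⟨by rintro (_ | _) <;> simp [h, h1], by rintro (_ | _) <;> simp [h]⟩

theorem circleOf_secondArc_eq_circle₁ {σ : V → Bool} {v : V}
    (h : Γ.circle₁ σ v = Γ.circle₂ σ v) (o : Bool) :
    Γ.circleOf σ (Γ.secondArc o v) = Γ.circle₁ σ v := by
  cases o
  · exact (circleOf_eq_circle₁ h).1 _
  · exact (circleOf_eq_circle₁ h).2 _

/-- Every arc at `v` lies on one of the two circles at `v`. -/
theorem circleOf_eq_or (σ : V → Bool) (v : V) :
    (∀ a, Γ.circleOf σ (Γ.inArc v a) = Γ.circle₁ σ v ∨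
      Γ.circleOf σ (Γ.inArc v a) = Γ.circle₂ σ v) ∧
    ∀ a, Γ.circleOf σ (Γ.outArc v a) = Γ.circle₁ σ v ∨
      Γ.circleOf σ (Γ.outArc v a) = Γ.circle₂ σ v := by
  rw [circle₁_eq, circle₂_eq, secondArc]
  cases hv : σ v
  · have h1 := circleOf_in_eq_in (Γ := Γ) hv
    have h2 := circleOf_out_eq_out (Γ := Γ) hv
    exact ⟨by rintro (_ | _) <;> simp [h1], by rintro (_ | _) <;> simp [h2]⟩
  · have h1 := circleOf_in_eq_out (Γ := Γ) hv
    exact ⟨by rintro (_ | _) <;> simp [h1], by rintro (_ | _) <;> simp⟩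

section Parity

variable [Fintype V]

/-- Every arc that is not a closed loop has one start and one end at vertices, so it is counted
twice. -/
theorem sum_arcs_at_vertices (f : Γ.Arc → ZMod 2) :
    ∑ w, ∑ a, (f (Γ.inArc w a) + f (Γ.outArc w a)) = 0 := by
  rw [← Fintype.sum_prod_type' (f := fun w a => f (Γ.inArc w a) + f (Γ.outArc w a)),
    Finset.sum_add_distrib]
  have : ∑ e : V × Side, f (Γ.inArc e.1 e.2) = ∑ e : V × Side, f (Γ.outArc e.1 e.2) :=
    Equiv.sum_comp Γ.next.symm fun e => f (Sum.inl e)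
  rw [this]
  exact CharTwo.add_self_eq_zero _

end Parity

variable [DecidableEq V]

theorem flip_apply_self (σ : V → Bool) (v : V) : flip σ v v = !σ v := by simp [flip]

theorem flip_apply_of_ne (σ : V → Bool) {v w : V} (h : w ≠ v) : flip σ v w = σ w := by
  simp [flip, h]

theorem flip_flip (σ : V → Bool) (v : V) : flip (flip σ v) v = σ := by simp [flip]

theorem flip_comm (σ : V → Bool) {v w : V} (h : v ≠ w) :
    flip (flip σ v) w = flip (flip σ w) v := by
  simp only [flip, Function.update_of_ne h, Function.update_of_ne h.symm]
  exact Function.update_comm h _ _ _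

/-- A saddle never joins two circles to two circles. -/
theorem circle₁_eq_circle₂_or_flip [Finite V] (σ : V → Bool) (v : V) :
    Γ.circle₁ σ v = Γ.circle₂ σ v ∨
      Γ.circle₁ (flip σ v) v = Γ.circle₂ (flip σ v) v := by
  wlog hv : σ v = true generalizing σ
  · have := this (flip σ v) (by rw [flip_apply_self]; simpa using hv)
    rw [flip_flip] at this
    exact this.symm
  classical
  have := Fintype.ofFinite V
  by_contra! hne
  obtain ⟨h1, h2⟩ := hne
  have hv' : flip σ v v = false := by rw [flip_apply_self, hv]; rfl
  simp only [circle₁_eq, circle₂_eq, secondArc, hv, hv', if_true, Bool.false_eq_true,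
    if_false] at h1 h2
  have e1 := circleOf_in_eq_out (Γ := Γ) hv
  have e2 := circleOf_in_eq_in (Γ := Γ) hv'
  have e3 := circleOf_out_eq_out (Γ := Γ) hv'
  -- `f` marks the arcs that share the circle of the lower left arc both before and after the
  -- change. At other vertices it is constant on each piece, so the contributions cancel; at `v`
  -- only the lower left end counts, which makes the total odd.
  let f : Γ.Arc → ZMod 2 := fun α =>
    if Γ.circleOf σ α = Γ.circleOf σ (Γ.inArc v Side.left) ∧
      Γ.circleOf (flip σ v) α = Γ.circleOf (flip σ v) (Γ.inArc v Side.left) then 1 else 0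
  have hsum := sum_arcs_at_vertices f
  rw [Finset.sum_eq_single v] at hsum
  · rw [Side.sum_eq] at hsum
    simp only [f, e1, ← e3, ← e2, h1.symm, h2, and_true, if_true, if_false,
      and_false] at hsum
    exact absurd hsum (by decide)
  · intro w _ hw
    rw [Side.sum_eq]
    have hw' := flip_apply_of_ne σ hw
    cases hσ : σ w
    · rw [hσ] at hw'
      simp only [f, circleOf_in_eq_in hσ, circleOf_in_eq_in hw', circleOf_out_eq_out hσ,
        circleOf_out_eq_out hw']
      exact CharTwo.add_self_eq_zero _
    · rw [hσ] at hw'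
      simp only [f, circleOf_in_eq_out hσ, circleOf_in_eq_out hw', CharTwo.add_self_eq_zero]
  · simp

/-- If the two pieces at `v` lie on one circle, then the smoothing that is changed at `v` has the
same circles, or this one circle is split. -/
theorem circleOf_eq_of_flip {σ : V → Bool} {v : V} (h : Γ.circle₁ σ v = Γ.circle₂ σ v)
    {α β : Γ.Arc} (e : Γ.circleOf (flip σ v) α = Γ.circleOf (flip σ v) β) :
    Γ.circleOf σ α = Γ.circleOf σ β := by
  obtain ⟨hi, ho⟩ := circleOf_eq_circle₁ h
  refine eq_of_circleOf_eq (Γ.circleOf σ) (fun w hw a => ?_) (fun w hw => ?_) e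
  · by_cases hwv : w = v
    · rw [hwv, hi, ho]
    · exact circleOf_in_eq_out (by rwa [flip_apply_of_ne σ hwv] at hw) a
  · by_cases hwv : w = v
    · simp only [hwv, hi, ho, and_self]
    · rw [flip_apply_of_ne σ hwv] at hw
      exact ⟨circleOf_in_eq_in hw, circleOf_out_eq_out hw⟩

theorem circleOf_flip_eq {σ : V → Bool} {v : V}
    (h : Γ.circle₁ (flip σ v) v = Γ.circle₂ (flip σ v) v)
    {α β : Γ.Arc} (e : Γ.circleOf σ α = Γ.circleOf σ β) :
    Γ.circleOf (flip σ v) α = Γ.circleOf (flip σ v) β :=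
  circleOf_eq_of_flip h (by rwa [flip_flip])

/-- If the two pieces at `v` lie on one circle, then two arcs on the same circle lie on the same
circle after the change at `v`, or both lie on a circle that meets `v`. -/
theorem circleOf_flip_eq_or {σ : V → Bool} {v : V} {α β : Γ.Arc}
    (e : Γ.circleOf (flip σ v) α = Γ.circleOf (flip σ v) β) :
    Γ.circleOf σ α = Γ.circleOf σ β ∨
      (Γ.circleOf σ α = Γ.circle₁ σ v ∨ Γ.circleOf σ α = Γ.circle₂ σ v) ∧
      (Γ.circleOf σ β = Γ.circle₁ σ v ∨ Γ.circleOf σ β = Γ.circle₂ σ v) := by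
  classical
  -- Identifying the two circles at `v` gives a function that no longer depends on the smoothing at
  -- `v`, hence is constant on the circles of `flip σ v`.
  let h : Γ.Arc → Γ.Circle σ := fun γ =>
    if Γ.circleOf σ γ = Γ.circle₂ σ v then Γ.circle₁ σ v else Γ.circleOf σ γ
  have hh : ∀ γ, Γ.circleOf σ γ = Γ.circle₁ σ v ∨ Γ.circleOf σ γ = Γ.circle₂ σ v →
      h γ = Γ.circle₁ σ v := by
    rintro γ (hγ | hγ) <;> simp [h, hγ]
  obtain ⟨hi, ho⟩ := circleOf_eq_or (Γ := Γ) σ v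
  have key : h α = h β := by
    refine eq_of_circleOf_eq h (fun w hw a => ?_) (fun w hw => ?_) e
    · by_cases hwv : w = v
      · rw [hwv, hh _ (hi _), hh _ (ho _)]
      · simp only [h, circleOf_in_eq_out (by rwa [flip_apply_of_ne σ hwv] at hw : σ w = true)]
    · by_cases hwv : w = v
      · rw [hwv]; simp only [hh _ (hi _), hh _ (ho _), and_self]
      · rw [flip_apply_of_ne σ hwv] at hw
        simp only [h, circleOf_in_eq_in hw, circleOf_out_eq_out hw, and_self]
  simp only [h] at key
  split_ifs at key with h1 h2 h2
  · exact Or.inl (h1.trans h2.symm)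
  · exact Or.inr ⟨Or.inr h1, Or.inl key.symm⟩
  · exact Or.inr ⟨Or.inl key, Or.inr h2⟩
  · exact Or.inl key

end Circles

end OrientedGraph

/-! ## Saddles as maps of modules

The tensor power `Z_A` of a smoothing is a cyclic module over the algebra generated by the
multiplications with `x` on the circles, and saddles are maps of modules. -/

namespace OrientedGraph

section Saddle

variable {V : Type*} {Γ : OrientedGraph V}

open Classical in
/-- Multiplication by `x` on the circle `C`. -/
def mulX {σ : V → Bool} (C : Γ.Circle σ) :
    (Γ.Labeling σ → ZMod 2) →ₗ[ZMod 2] (Γ.Labeling σ → ZMod 2) where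
  toFun f ρ := if ρ C = Label.x then f (Function.update ρ C Label.one) else 0
  map_add' f g := by ext ρ; by_cases h : ρ C = Label.x <;> simp [h]
  map_smul' c f := by ext ρ; by_cases h : ρ C = Label.x <;> simp [h]

open Classical in
theorem mulX_apply {σ : V → Bool} (C : Γ.Circle σ) (f : Γ.Labeling σ → ZMod 2)
    (ρ : Γ.Labeling σ) :
    mulX C f ρ = if ρ C = Label.x then f (Function.update ρ C Label.one) else 0 := rfl

theorem mulX_mulX {σ : V → Bool} (C : Γ.Circle σ) (f : Γ.Labeling σ → ZMod 2) :
    mulX C (mulX C f) = 0 := by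
  ext ρ
  simp [mulX_apply]

theorem mulX_comm {σ : V → Bool} (C C' : Γ.Circle σ) (f : Γ.Labeling σ → ZMod 2) :
    mulX C (mulX C' f) = mulX C' (mulX C f) := by
  classical
  by_cases h : C = C'
  · rw [h]
  · ext ρ
    simp only [mulX_apply, Function.update_of_ne h, Function.update_of_ne (Ne.symm h),
      Function.update_comm h]
    split_ifs <;> rfl

open Classical in
/-- The basis element of `Z_A` for a labeling. -/
def enhanced {σ : V → Bool} (ρ : Γ.Labeling σ) : Γ.Labeling σ → ZMod 2 :=
  fun τ => if τ = ρ then 1 else 0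

theorem enhanced_apply {σ : V → Bool} (ρ τ : Γ.Labeling σ) [Decidable (τ = ρ)] :
    enhanced ρ τ = if τ = ρ then 1 else 0 := by
  rw [enhanced]
  congr

theorem linearMap_ext_enhanced [Finite V] {M : Type*} [AddCommMonoid M] [Module (ZMod 2) M]
    {σ : V → Bool} {P Q : (Γ.Labeling σ → ZMod 2) →ₗ[ZMod 2] M}
    (h : ∀ ρ, P (enhanced ρ) = Q (enhanced ρ)) : P = Q := by
  classical
  refine LinearMap.pi_ext' fun ρ => LinearMap.ext_ring ?_
  have : (Pi.single ρ 1 : Γ.Labeling σ → ZMod 2) = enhanced ρ := by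
    ext τ
    rw [enhanced_apply, Pi.single_apply]
  rw [LinearMap.comp_apply, LinearMap.comp_apply, LinearMap.single_apply, this, h]

open Classical in
theorem mulX_enhanced {σ : V → Bool} (C : Γ.Circle σ) (ρ : Γ.Labeling σ) :
    mulX C (enhanced ρ) = if ρ C = Label.one then enhanced (Function.update ρ C Label.x) else 0 := by
  ext τ
  have key : (τ C = Label.x ∧ Function.update τ C Label.one = ρ) ↔
      (ρ C = Label.one ∧ τ = Function.update ρ C Label.x) := by
    constructor
    · rintro ⟨h, rfl⟩
      simp [← h]
    · rintro ⟨h, rfl⟩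
      simp [← h]
  rw [mulX_apply, apply_ite (fun f : Γ.Labeling σ → ZMod 2 => f τ)]
  simp only [enhanced_apply, Pi.zero_apply, ← ite_and, key]

/-- The unit of `Z_A`. -/
def unit (Γ : OrientedGraph V) (σ : V → Bool) : Γ.Labeling σ → ZMod 2 :=
  enhanced fun _ => Label.one

/-- The unit generates `Z_A`: maps of modules which agree on the
unit are equal. -/
theorem linearMap_ext_unit [Finite V] {σ σ' : V → Bool}
    {P Q : (Γ.Labeling σ → ZMod 2) →ₗ[ZMod 2] (Γ.Labeling σ' → ZMod 2)}
    (hP : ∀ α f, P (mulX (Γ.circleOf σ α) f) = mulX (Γ.circleOf σ' α) (P f))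
    (hQ : ∀ α f, Q (mulX (Γ.circleOf σ α) f) = mulX (Γ.circleOf σ' α) (Q f))
    (h : P (unit Γ σ) = Q (unit Γ σ)) : P = Q := by
  classical
  -- Induction on the number of circles labelled `x`: one factor `x` at a time is pulled out through
  -- `P` and `Q`.
  have key : ∀ n : ℕ, ∀ ρ : Γ.Labeling σ,
      (Finset.univ.filter fun C => ρ C = Label.x).card = n →
        P (enhanced ρ) = Q (enhanced ρ) := by
    intro n
    induction n with
    | zero =>
      intro ρ hρ
      have : ρ = fun _ => Label.one := by
        funext C
        have : C ∉ Finset.univ.filter fun C => ρ C = Label.x := by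
          rw [Finset.card_eq_zero.mp hρ]; simp
        cases hC : ρ C
        · rfl
        · simp [hC] at this
      rw [this]
      exact h
    | succ n ih =>
      intro ρ hρ
      obtain ⟨C, hC⟩ := Finset.card_pos.mp (by rw [hρ]; exact n.succ_pos)
      have hC' : ρ C = Label.x := by simpa using hC
      obtain ⟨α, rfl⟩ := circleOf_surjective σ C
      have e : enhanced ρ = mulX (Γ.circleOf σ α)
          (enhanced (Function.update ρ (Γ.circleOf σ α) Label.one)) := by
        rw [mulX_enhanced]
        simp [← hC']
      rw [e, hP, hQ, ih]
      have : (Finset.univ.filter fun D =>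
          Function.update ρ (Γ.circleOf σ α) Label.one D = Label.x) =
          (Finset.univ.filter fun D => ρ D = Label.x).erase (Γ.circleOf σ α) := by
        ext D
        by_cases hD : D = Γ.circleOf σ α
        · subst hD; simp
        · simp [hD]
      rw [this, Finset.card_erase_of_mem hC, hρ, Nat.add_sub_cancel]
  exact linearMap_ext_enhanced fun ρ => key _ ρ rfl

/-- The saddle at `v` as a linear map. -/
def saddle [Finite V] (Γ : OrientedGraph V) (v : V) (σ σ' : V → Bool) :
    (Γ.Labeling σ → ZMod 2) →ₗ[ZMod 2] (Γ.Labeling σ' → ZMod 2) :=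
  Matrix.mulVecLin (Matrix.of fun ρ' ρ => Γ.saddleCoeff v σ σ' ρ ρ')

theorem saddle_apply [Finite V] (v : V) (σ σ' : V → Bool) (f : Γ.Labeling σ → ZMod 2)
    (ρ' : Γ.Labeling σ') :
    saddle Γ v σ σ' f ρ' = ∑ ρ, Γ.saddleCoeff v σ σ' ρ ρ' * f ρ := rfl

theorem saddle_enhanced [Finite V] (v : V) (σ σ' : V → Bool) (ρ : Γ.Labeling σ)
    (ρ' : Γ.Labeling σ') :
    saddle Γ v σ σ' (enhanced ρ) ρ' = Γ.saddleCoeff v σ σ' ρ ρ' := by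
  rw [saddle_apply, Finset.sum_eq_single ρ]
  · simp [enhanced]
  · intro τ _ h; simp [enhanced, h]
  · simp

/-- The circle of `α` meets the vertex `v`. -/
def Meets (σ : V → Bool) (v : V) (α : Γ.Arc) : Prop :=
  Γ.circleOf σ α = Γ.circle₁ σ v ∨ Γ.circleOf σ α = Γ.circle₂ σ v

/-- The labels of the circles that do not meet `v` are the same. -/
def Agree (v : V) {σ σ' : V → Bool} (ρ : Γ.Labeling σ) (ρ' : Γ.Labeling σ') : Prop :=
  ∀ α : Γ.Arc, ¬ Meets σ v α → ρ' (Γ.circleOf σ' α) = ρ (Γ.circleOf σ α)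

open Classical in
theorem saddleCoeff_eq (v : V) (σ σ' : V → Bool) (ρ : Γ.Labeling σ) (ρ' : Γ.Labeling σ') :
    Γ.saddleCoeff v σ σ' ρ ρ' = if Agree v ρ ρ' then
      if Γ.circle₁ σ v ≠ Γ.circle₂ σ v ∧ Γ.circle₁ σ' v = Γ.circle₂ σ' v then
        Label.mulCoeff (ρ (Γ.circle₁ σ v)) (ρ (Γ.circle₂ σ v)) (ρ' (Γ.circle₁ σ' v))
      else if Γ.circle₁ σ v = Γ.circle₂ σ v ∧ Γ.circle₁ σ' v ≠ Γ.circle₂ σ' v then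
        Label.comulCoeff (ρ (Γ.circle₁ σ v)) (ρ' (Γ.circle₁ σ' v)) (ρ' (Γ.circle₂ σ' v))
      else 0
    else 0 := by
  simp only [saddleCoeff, Agree, Meets, not_or, and_imp]

open Classical in
theorem saddleCoeff_of_merge {v : V} {σ σ' : V → Bool} (h : Γ.circle₁ σ v ≠ Γ.circle₂ σ v)
    (h' : Γ.circle₁ σ' v = Γ.circle₂ σ' v) (ρ : Γ.Labeling σ) (ρ' : Γ.Labeling σ') :
    Γ.saddleCoeff v σ σ' ρ ρ' = if Agree v ρ ρ' then
      Label.mulCoeff (ρ (Γ.circle₁ σ v)) (ρ (Γ.circle₂ σ v)) (ρ' (Γ.circle₁ σ' v)) else 0 := by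
  rw [saddleCoeff_eq]
  simp only [h, h', ne_eq, not_false_eq_true, and_self, if_true]

open Classical in
theorem saddleCoeff_of_split {v : V} {σ σ' : V → Bool} (h : Γ.circle₁ σ v = Γ.circle₂ σ v)
    (h' : Γ.circle₁ σ' v ≠ Γ.circle₂ σ' v) (ρ : Γ.Labeling σ) (ρ' : Γ.Labeling σ') :
    Γ.saddleCoeff v σ σ' ρ ρ' = if Agree v ρ ρ' then
      Label.comulCoeff (ρ (Γ.circle₁ σ v)) (ρ' (Γ.circle₁ σ' v)) (ρ' (Γ.circle₂ σ' v))
      else 0 := by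
  rw [saddleCoeff_eq]
  simp only [h, h', ne_eq, not_false_eq_true, not_true_eq_false, and_self, if_true,
    if_false]

open Classical in
theorem agree_update_left {σ σ' : V → Bool} {v : V} {α : Γ.Arc} (h : Meets σ v α) (l : Label)
    (ρ : Γ.Labeling σ) (ρ' : Γ.Labeling σ') :
    Agree v (Function.update ρ (Γ.circleOf σ α) l) ρ' ↔ Agree v ρ ρ' := by
  refine forall₂_congr fun β hβ => ?_
  rw [Function.update_of_ne]
  rintro e
  exact hβ (by rwa [Meets, e])

theorem ne_of_not_meets {σ : V → Bool} {v : V} {α : Γ.Arc} (h : ¬ Meets σ v α) :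
    Γ.circle₁ σ v ≠ Γ.circleOf σ α ∧ Γ.circle₂ σ v ≠ Γ.circleOf σ α :=
  ⟨fun e => h (Or.inl e.symm), fun e => h (Or.inr e.symm)⟩

variable [DecidableEq V]

/-- The four ends at `v` lie on the circles at `v` for either smoothing, and a circle is altered
only if it passes through them. -/
theorem meets_flip {σ : V → Bool} {v : V} {α : Γ.Arc} (h : Meets σ v α) :
    Meets (flip σ v) v α := by
  have key : ∀ β, Meets (flip σ v) v β → Γ.circleOf σ α = Γ.circleOf σ β →
      Meets (flip σ v) v α := by
    intro β hβ e
    rw [← flip_flip σ v] at e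
    obtain e' | e' := circleOf_flip_eq_or e
    · rwa [Meets, e']
    · exact e'.1
  obtain ⟨hi, ho⟩ := circleOf_eq_or (Γ := Γ) (flip σ v) v
  obtain h | h := h
  · exact key _ (ho _) h
  · refine key _ ?_ h
    split_ifs
    · exact ho _
    · exact hi _

theorem meets_flip_iff (σ : V → Bool) (v : V) (α : Γ.Arc) :
    Meets (flip σ v) v α ↔ Meets σ v α :=
  ⟨fun h => by simpa [flip_flip] using meets_flip h, meets_flip⟩

/-- A circle away from `v` consists of the same arcs before and after the change. -/
theorem circleOf_flip_eq_iff {σ : V → Bool} {v : V} {α : Γ.Arc} (h : ¬ Meets σ v α)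
    (β : Γ.Arc) :
    Γ.circleOf (flip σ v) β = Γ.circleOf (flip σ v) α ↔
      Γ.circleOf σ β = Γ.circleOf σ α := by
  constructor
  · intro e
    exact (circleOf_flip_eq_or e).resolve_right fun h' => h h'.2
  · intro e
    rw [← flip_flip σ v] at e
    refine (circleOf_flip_eq_or e).resolve_right fun h' => h ?_
    exact (meets_flip_iff σ v α).mp h'.2

theorem agree_flip_iff {σ : V → Bool} {v : V} (ρ : Γ.Labeling σ)
    (ρ' : Γ.Labeling (flip σ v)) : Agree v ρ' ρ ↔ Agree v ρ ρ' := by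
  simp only [Agree, meets_flip_iff, eq_comm]

open Classical in
theorem agree_update_right {σ : V → Bool} {v : V} {α : Γ.Arc} (h : Meets σ v α) (l : Label)
    (ρ : Γ.Labeling σ) (ρ' : Γ.Labeling (flip σ v)) :
    Agree v ρ (Function.update ρ' (Γ.circleOf (flip σ v) α) l) ↔ Agree v ρ ρ' := by
  rw [← agree_flip_iff, agree_update_left (meets_flip h), agree_flip_iff]

open Classical in
theorem agree_update_of_not_meets {σ : V → Bool} {v : V} {α : Γ.Arc} (h : ¬ Meets σ v α)
    (ρ : Γ.Labeling σ) (ρ' : Γ.Labeling (flip σ v)) :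
    ρ (Γ.circleOf σ α) = Label.one ∧
        Agree v (Function.update ρ (Γ.circleOf σ α) Label.x) ρ' ↔
      ρ' (Γ.circleOf (flip σ v) α) = Label.x ∧
        Agree v ρ (Function.update ρ' (Γ.circleOf (flip σ v) α) Label.one) := by
  constructor
  · rintro ⟨h1, h2⟩
    refine ⟨by simpa using h2 α h, fun β hβ => ?_⟩
    have := h2 β hβ
    by_cases e : Γ.circleOf σ β = Γ.circleOf σ α
    · rw [e, (circleOf_flip_eq_iff h β).mpr e, Function.update_self, h1]
    · rw [Function.update_of_ne e] at this
      rwa [Function.update_of_ne (mt (circleOf_flip_eq_iff h β).mp e)]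
  · rintro ⟨h1, h2⟩
    refine ⟨by simpa using (h2 α h).symm, fun β hβ => ?_⟩
    have := h2 β hβ
    by_cases e : Γ.circleOf σ β = Γ.circleOf σ α
    · rw [e, (circleOf_flip_eq_iff h β).mpr e, Function.update_self, h1]
    · rw [Function.update_of_ne (mt (circleOf_flip_eq_iff h β).mp e)] at this
      rwa [Function.update_of_ne e]

open Classical in
-- This is `saddle_mulX` in matrix coefficients. On a circle at `v` it is the `A`-linearity of
-- multiplication and comultiplication, a finite check on labels; on any other circle the label is
-- simply carried along.
theorem saddleCoeff_update {σ : V → Bool} {v : V} (α : Γ.Arc) (ρ : Γ.Labeling σ)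
    (ρ' : Γ.Labeling (flip σ v)) :
    (if ρ (Γ.circleOf σ α) = Label.one then
        Γ.saddleCoeff v σ (flip σ v) (Function.update ρ (Γ.circleOf σ α) Label.x) ρ' else 0) =
      if ρ' (Γ.circleOf (flip σ v) α) = Label.x then
        Γ.saddleCoeff v σ (flip σ v) ρ
          (Function.update ρ' (Γ.circleOf (flip σ v) α) Label.one) else 0 := by
  simp only [saddleCoeff_eq]
  by_cases h : Meets σ v α
  · simp only [agree_update_left h, agree_update_right h]
    by_cases hA : Agree v ρ ρ'
    swap
    · simp [hA]
    simp only [hA, if_true]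
    have h' := meets_flip h
    by_cases hm : Γ.circle₁ σ v ≠ Γ.circle₂ σ v ∧
        Γ.circle₁ (flip σ v) v = Γ.circle₂ (flip σ v) v
    · simp only [if_pos hm]
      have e' : Γ.circleOf (flip σ v) α = Γ.circle₁ (flip σ v) v := by
        obtain h' | h' := h'
        · exact h'
        · exact h'.trans hm.2.symm
      rw [e']
      obtain h | h := h
      · rw [h, Function.update_self, Function.update_self, Function.update_of_ne hm.1.symm]
        generalize ρ (Γ.circle₁ σ v) = p
        generalize ρ (Γ.circle₂ σ v) = q
        generalize ρ' (Γ.circle₁ (flip σ v) v) = r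
        revert p q r
        decide
      · rw [h, Function.update_self, Function.update_self, Function.update_of_ne hm.1]
        generalize ρ (Γ.circle₁ σ v) = p
        generalize ρ (Γ.circle₂ σ v) = q
        generalize ρ' (Γ.circle₁ (flip σ v) v) = r
        revert p q r
        decide
    · simp only [if_neg hm]
      by_cases hs : Γ.circle₁ σ v = Γ.circle₂ σ v ∧
          Γ.circle₁ (flip σ v) v ≠ Γ.circle₂ (flip σ v) v
      swap
      · simp [if_neg hs]
      simp only [if_pos hs]
      have e : Γ.circleOf σ α = Γ.circle₁ σ v := by
        obtain h | h := h
        · exact h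
        · exact h.trans hs.1.symm
      rw [e]
      obtain h' | h' := h'
      · rw [h', Function.update_self, Function.update_self, Function.update_of_ne hs.2.symm]
        generalize ρ (Γ.circle₁ σ v) = p
        generalize ρ' (Γ.circle₂ (flip σ v) v) = q
        generalize ρ' (Γ.circle₁ (flip σ v) v) = r
        revert p q r
        decide
      · rw [h', Function.update_self, Function.update_self, Function.update_of_ne hs.2]
        generalize ρ (Γ.circle₁ σ v) = p
        generalize ρ' (Γ.circle₂ (flip σ v) v) = q
        generalize ρ' (Γ.circle₁ (flip σ v) v) = r
        revert p q r
        decide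
  · obtain ⟨h1, h2⟩ := ne_of_not_meets h
    obtain ⟨h1', h2'⟩ := ne_of_not_meets (mt (meets_flip_iff σ v α).mp h)
    simp only [Function.update_of_ne h1, Function.update_of_ne h2, Function.update_of_ne h1',
      Function.update_of_ne h2', ← ite_and, agree_update_of_not_meets h]

theorem saddle_mulX [Finite V] {σ : V → Bool} {v : V} (α : Γ.Arc) (f : Γ.Labeling σ → ZMod 2) :
    saddle Γ v σ (flip σ v) (mulX (Γ.circleOf σ α) f) =
      mulX (Γ.circleOf (flip σ v) α) (saddle Γ v σ (flip σ v) f) := by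
  classical
  suffices h : saddle Γ v σ (flip σ v) ∘ₗ mulX (Γ.circleOf σ α) =
      mulX (Γ.circleOf (flip σ v) α) ∘ₗ saddle Γ v σ (flip σ v) from LinearMap.congr_fun h f
  refine linearMap_ext_enhanced fun ρ => ?_
  ext ρ'
  simp only [LinearMap.comp_apply, mulX_enhanced, mulX_apply,
    saddle_enhanced]
  rw [← saddleCoeff_update]
  split_ifs
  · exact saddle_enhanced ..
  · simp

theorem agree_one_iff {σ : V → Bool} {v : V} (ρ' : Γ.Labeling (flip σ v)) :
    Agree v (fun _ : Γ.Circle σ => Label.one) ρ' ↔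
      ∀ C, C ≠ Γ.circle₁ (flip σ v) v → C ≠ Γ.circle₂ (flip σ v) v → ρ' C = Label.one := by
  rw [(circleOf_surjective (flip σ v)).forall]
  simp only [← and_imp, ← not_or]
  exact forall_congr' fun α => imp_congr_left (not_congr (meets_flip_iff σ v α).symm)

/-- A saddle that merges two circles preserves the unit. -/
theorem saddle_unit_of_ne [Finite V] {σ : V → Bool} {v : V}
    (h : Γ.circle₁ σ v ≠ Γ.circle₂ σ v) :
    saddle Γ v σ (flip σ v) (unit Γ σ) = unit Γ (flip σ v) := by
  classical
  have h' := (circle₁_eq_circle₂_or_flip (Γ := Γ) σ v).resolve_left h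
  ext ρ'
  rw [unit, saddle_enhanced, saddleCoeff_of_merge h h', unit, enhanced_apply,
    agree_one_iff, ← h']
  by_cases hρ : ρ' = fun _ => Label.one
  · subst hρ; simp [Label.mulCoeff]
  · rw [if_neg hρ]
    split_ifs with hA
    · cases hx : ρ' (Γ.circle₁ (flip σ v) v)
      · refine absurd (funext fun C => ?_) hρ
        by_cases hC : C = Γ.circle₁ (flip σ v) v
        · rw [hC, hx]
        · exact hA C hC hC
      · rfl
    · rfl

/-- A saddle that does not merge two circles maps the unit to the sum of the elements `x` of the
two circles. (If they are the same circle, then this is zero.) -/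
theorem saddle_unit_of_eq [Finite V] {σ : V → Bool} {v : V}
    (h : Γ.circle₁ σ v = Γ.circle₂ σ v) :
    saddle Γ v σ (flip σ v) (unit Γ σ) =
      mulX (Γ.circle₁ (flip σ v) v) (unit Γ (flip σ v)) +
        mulX (Γ.circle₂ (flip σ v) v) (unit Γ (flip σ v)) := by
  classical
  by_cases h' : Γ.circle₁ (flip σ v) v = Γ.circle₂ (flip σ v) v
  · ext ρ'
    rw [unit, saddle_enhanced, saddleCoeff_eq, h', Pi.add_apply, CharTwo.add_self_eq_zero]
    simp [h]
  ext ρ'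
  have key : ∀ C D : Γ.Circle (flip σ v), C ≠ D →
      (∀ E, E ≠ C → E ≠ D → ρ' E = Label.one) →
      (ρ' = Function.update (fun _ => Label.one) C Label.x ↔
        ρ' C = Label.x ∧ ρ' D = Label.one) := by
    intro C D hCD hE
    constructor
    · rintro rfl
      simp [hCD.symm]
    · rintro ⟨hC, hD⟩
      funext E
      by_cases e : E = C
      · simp [e, hC]
      · by_cases e' : E = D
        · simp [e', hD, hCD.symm]
        · simp [e, hE E e e']
  rw [unit, saddle_enhanced, saddleCoeff_of_split h h', unit,
    mulX_enhanced, mulX_enhanced, if_pos rfl, if_pos rfl, Pi.add_apply, enhanced_apply,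
    enhanced_apply, agree_one_iff]
  split_ifs with hA h1 h2 h2 h1 h2 h2
  · exact absurd (congrFun (h1.symm.trans h2) (Γ.circle₁ (flip σ v) v)) (by simp [h'])
  · obtain ⟨e1, e2⟩ := (key _ _ h' hA).mp h1
    rw [e1, e2]; rfl
  · obtain ⟨e1, e2⟩ := (key _ _ (Ne.symm h') fun E a b => hA E b a).mp h2
    rw [e1, e2]; rfl
  · rw [key _ _ h' hA] at h1
    rw [key _ _ (Ne.symm h') fun E a b => hA E b a] at h2
    generalize ρ' (Γ.circle₁ (flip σ v) v) = p at *
    generalize ρ' (Γ.circle₂ (flip σ v) v) = q at *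
    revert p q
    decide
  · refine absurd (fun E hE _ => ?_) hA
    rw [h1, Function.update_of_ne hE]
  · refine absurd (fun E hE _ => ?_) hA
    rw [h1, Function.update_of_ne hE]
  · refine absurd (fun E _ hE => ?_) hA
    rw [h2, Function.update_of_ne hE]
  · rfl

end Saddle

end OrientedGraph

/-! ## Saddles at different vertices commute -/

namespace OrientedGraph

section Commute

variable {V : Type*} {Γ : OrientedGraph V}

/-- The sum of the multiplications with `x` on the two circles at `v`. -/
def mulPair {σ : V → Bool} (o : Bool) (v : V) :
    (Γ.Labeling σ → ZMod 2) →ₗ[ZMod 2] (Γ.Labeling σ → ZMod 2) :=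
  mulX (Γ.circleOf σ (Γ.outArc v Side.left)) + mulX (Γ.circleOf σ (Γ.secondArc o v))

theorem mulPair_of_eq {σ : V → Bool} {v : V} (h : Γ.circle₁ σ v = Γ.circle₂ σ v) (o : Bool) :
    mulPair (Γ := Γ) (σ := σ) o v = 0 := by
  rw [mulPair, circleOf_secondArc_eq_circle₁ h, circle₁_eq]
  ext f ρ
  exact CharTwo.add_self_eq_zero _

theorem mulPair_self (σ : V → Bool) (v : V) :
    mulPair (σ v) v = mulX (Γ.circle₁ σ v) + mulX (Γ.circle₂ σ v) := rfl

theorem mulPair_mulPair {σ : V → Bool} (o : Bool) (v : V) (f : Γ.Labeling σ → ZMod 2) :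
    mulPair o v (mulPair o v f) = 0 := by
  simp only [mulPair, LinearMap.add_apply, map_add, mulX_mulX, zero_add, add_zero]
  rw [mulX_comm]
  ext ρ
  exact CharTwo.add_self_eq_zero _

theorem mulPair_comm {σ : V → Bool} (o o' : Bool) (v w : V) (f : Γ.Labeling σ → ZMod 2) :
    mulPair o v (mulPair o' w f) = mulPair o' w (mulPair o v f) := by
  simp only [mulPair, LinearMap.add_apply, map_add]
  rw [mulX_comm (Γ.circleOf σ (Γ.outArc v Side.left)),
    mulX_comm (Γ.circleOf σ (Γ.outArc v Side.left)),
    mulX_comm (Γ.circleOf σ (Γ.secondArc o v)), mulX_comm (Γ.circleOf σ (Γ.secondArc o v))]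
  abel

variable [DecidableEq V] {σ σ₁ σ₂ σ₃ : V → Bool} {v w : V}

/-- If two circles at `v` are joined by the change at `w`, then these are the two circles at `w`. -/
theorem circle_eq_or_of_flip (h₂ : σ₂ = flip σ w) (hvw : v ≠ w)
    (h : Γ.circle₁ σ v ≠ Γ.circle₂ σ v) (h' : Γ.circle₁ σ₂ v = Γ.circle₂ σ₂ v) :
    Γ.circle₁ σ w ≠ Γ.circle₂ σ w ∧
      ((Γ.circle₁ σ v = Γ.circle₁ σ w ∧ Γ.circle₂ σ v = Γ.circle₂ σ w) ∨
        (Γ.circle₁ σ v = Γ.circle₂ σ w ∧ Γ.circle₂ σ v = Γ.circle₁ σ w)) := by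
  subst h₂
  rw [circle₂_eq _ (flip σ w), flip_apply_of_ne σ hvw] at h'
  have hw : Γ.circle₁ σ w ≠ Γ.circle₂ σ w := fun e => h (circleOf_eq_of_flip e h')
  refine ⟨hw, ?_⟩
  obtain e | ⟨e1, e2⟩ := circleOf_flip_eq_or h'
  · exact absurd e h
  · rw [← circle₁_eq] at e1
    rw [← circle₂_eq] at e2
    obtain e1 | e1 := e1 <;> obtain e2 | e2 := e2
    · exact absurd (e1.trans e2.symm) h
    · exact Or.inl ⟨e1, e2⟩
    · exact Or.inr ⟨e1, e2⟩
    · exact absurd (e1.trans e2.symm) h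

variable [Finite V]

/-- The smoothings met in the complex equal flips of one another only propositionally. Keeping
source and target as variables tied by an equation avoids transporting labelings. -/
theorem saddle_mulX' (h : σ₁ = flip σ v) (α : Γ.Arc) (f : Γ.Labeling σ → ZMod 2) :
    saddle Γ v σ σ₁ (mulX (Γ.circleOf σ α) f) =
      mulX (Γ.circleOf σ₁ α) (saddle Γ v σ σ₁ f) := by
  subst h
  exact saddle_mulX α f

/-- `mulPair` names its circles through arcs, with `o` fixed, so that the same pair of arcs can be
followed through a saddle even when the smoothing at its own vertex changes. -/
theorem saddle_mulPair (h : σ₁ = flip σ v) (o : Bool) (w : V) (f : Γ.Labeling σ → ZMod 2) :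
    saddle Γ v σ σ₁ (mulPair o w f) = mulPair o w (saddle Γ v σ σ₁ f) := by
  simp only [mulPair, LinearMap.add_apply, map_add, saddle_mulX' h]

open Classical in
theorem saddle_unit (h : σ₁ = flip σ v) :
    saddle Γ v σ σ₁ (unit Γ σ) =
      if Γ.circle₁ σ v = Γ.circle₂ σ v then mulPair (σ₁ v) v (unit Γ σ₁) else unit Γ σ₁ := by
  subst h
  split_ifs with h
  · exact saddle_unit_of_eq h
  · exact saddle_unit_of_ne h

/-- The two circles at `v` are also the two circles at `w`, so the change at `v` merges them too. -/
theorem circle₁_eq_circle₂_of_merge (hvw : v ≠ w) (h₁ : σ₁ = flip σ v) (h₂ : σ₂ = flip σ w)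
    (h : Γ.circle₁ σ v ≠ Γ.circle₂ σ v) (h' : Γ.circle₁ σ₂ v = Γ.circle₂ σ₂ v) :
    Γ.circle₁ σ₁ w = Γ.circle₂ σ₁ w := by
  obtain ⟨-, hvw'⟩ := circle_eq_or_of_flip h₂ hvw h h'
  subst h₁
  have hv₁ := (circle₁_eq_circle₂_or_flip σ v).resolve_left h
  have e := circleOf_secondArc_eq_circle₁ hv₁ (σ v)
  rw [circle₁_eq] at e
  rw [circle₁_eq, circle₂_eq, flip_apply_of_ne σ hvw.symm]
  obtain ⟨e1, e2⟩ | ⟨e1, e2⟩ := hvw'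
  · exact (circleOf_flip_eq hv₁ e1).symm.trans (e.symm.trans (circleOf_flip_eq hv₁ e2))
  · exact (circleOf_flip_eq hv₁ e2).symm.trans (e.trans (circleOf_flip_eq hv₁ e1))

/-- Here `v` and `w` join the same two circles. After both changes either each vertex sees a single
circle and both sums vanish, or the merged circle has been split into two circles that are the pair
at `v` as well as at `w`. -/
theorem mulPair_eq_of_merge (hvw : v ≠ w) (h₁ : σ₁ = flip σ v) (h₂ : σ₂ = flip σ w)
    (h₃ : σ₃ = flip σ₁ w) (h₃' : σ₃ = flip σ₂ v)
    (h : Γ.circle₁ σ v ≠ Γ.circle₂ σ v) (h' : Γ.circle₁ σ₂ v = Γ.circle₂ σ₂ v) :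
    Γ.circle₁ σ w ≠ Γ.circle₂ σ w ∧ Γ.circle₁ σ₁ w = Γ.circle₂ σ₁ w ∧
      mulPair (Γ := Γ) (σ := σ₃) (σ₃ v) v = mulPair (σ₃ w) w := by
  obtain ⟨hw, -⟩ := circle_eq_or_of_flip h₂ hvw h h'
  have hv₁ : Γ.circle₁ σ₁ v = Γ.circle₂ σ₁ v := by
    subst h₁; exact (circle₁_eq_circle₂_or_flip σ v).resolve_left h
  have hw₁ := circle₁_eq_circle₂_of_merge hvw h₁ h₂ h h'
  have hw₂ : Γ.circle₁ σ₂ w = Γ.circle₂ σ₂ w := by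
    subst h₂; exact (circle₁_eq_circle₂_or_flip σ w).resolve_left hw
  refine ⟨hw, hw₁, ?_⟩
  by_cases hv₃ : Γ.circle₁ σ₃ v = Γ.circle₂ σ₃ v
  · have hw₃ : Γ.circle₁ σ₃ w = Γ.circle₂ σ₃ w := by
      by_contra hne
      exact (circle_eq_or_of_flip (by rw [h₃', flip_flip]) hvw.symm hne hw₂).1 hv₃
    rw [mulPair_of_eq hv₃, mulPair_of_eq hw₃]
  · have hf : σ₁ = flip σ₃ w := by rw [h₃, flip_flip]
    obtain ⟨-, ⟨e1, e2⟩ | ⟨e1, e2⟩⟩ := circle_eq_or_of_flip hf hvw hv₃ hv₁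
    · rw [mulPair_self, mulPair_self, e1, e2]
    · rw [mulPair_self, mulPair_self, e1, e2, add_comm]

/-- Seen backwards from `σ₂`, the circles at `v` are two circles that the change at `w` merges, so
the preceding lemmas apply with `σ₂` as the starting point. -/
theorem mulPair_eq_zero_of_split (hvw : v ≠ w) (h₂ : σ₂ = flip σ w) (h₃ : σ₃ = flip σ₂ v)
    (h : Γ.circle₁ σ v = Γ.circle₂ σ v) (h' : Γ.circle₁ σ₂ v ≠ Γ.circle₂ σ₂ v) :
    Γ.circle₁ σ w = Γ.circle₂ σ w ∧ mulPair (Γ := Γ) (σ := σ₃) (σ₃ v) v = 0 ∧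
      mulPair (Γ := Γ) (σ := σ₃) (σ₃ w) w = 0 := by
  have hf : σ = flip σ₂ w := by rw [h₂, flip_flip]
  obtain ⟨hw, -⟩ := circle_eq_or_of_flip hf hvw h' h
  have hw₃ := circle₁_eq_circle₂_of_merge hvw h₃ hf h' h
  refine ⟨?_, mulPair_of_eq ?_ _, mulPair_of_eq hw₃ _⟩
  · subst hf; exact (circle₁_eq_circle₂_or_flip σ₂ w).resolve_left hw
  · subst h₃; exact (circle₁_eq_circle₂_or_flip σ₂ v).resolve_left h'

/-- Saddles at different vertices commute. -/
theorem saddle_comm (hvw : v ≠ w) (h₁ : σ₁ = flip σ v) (h₂ : σ₂ = flip σ w)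
    (h₃ : σ₃ = flip σ₁ w) (h₃' : σ₃ = flip σ₂ v) (f : Γ.Labeling σ → ZMod 2) :
    saddle Γ w σ₁ σ₃ (saddle Γ v σ σ₁ f) = saddle Γ v σ₂ σ₃ (saddle Γ w σ σ₂ f) := by
  classical
  suffices h : saddle Γ w σ₁ σ₃ ∘ₗ saddle Γ v σ σ₁ = saddle Γ v σ₂ σ₃ ∘ₗ saddle Γ w σ σ₂ from
    LinearMap.congr_fun h f
  refine linearMap_ext_unit (fun α f => ?_) (fun α f => ?_) ?_
  · simp only [LinearMap.comp_apply, saddle_mulX' h₁, saddle_mulX' h₃]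
  · simp only [LinearMap.comp_apply, saddle_mulX' h₂, saddle_mulX' h₃']
  have ev : σ₃ v = σ₁ v := by rw [h₃, flip_apply_of_ne _ hvw]
  have ew : σ₃ w = σ₂ w := by rw [h₃', flip_apply_of_ne _ hvw.symm]
  simp only [LinearMap.comp_apply, saddle_unit h₁, saddle_unit h₂,
    apply_ite (saddle Γ w σ₁ σ₃), apply_ite (saddle Γ v σ₂ σ₃),
    saddle_mulPair h₃, saddle_mulPair h₃', saddle_unit h₃, saddle_unit h₃', ← ev, ← ew]
  -- If the change at either vertex leaves the number of circles at the other one unaltered, both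
  -- orders give the same product of pairs. The remaining cases are those of the merge and split
  -- lemmas.
  by_cases a : Γ.circle₁ σ v = Γ.circle₂ σ v <;> by_cases d : Γ.circle₁ σ₂ v = Γ.circle₂ σ₂ v
  · by_cases c : Γ.circle₁ σ w = Γ.circle₂ σ w <;>
      by_cases b : Γ.circle₁ σ₁ w = Γ.circle₂ σ₁ w
    · simp only [a, b, c, d, if_true, mulPair_comm (σ₃ v)]
    · obtain ⟨-, z, z'⟩ := mulPair_eq_zero_of_split hvw.symm h₁ h₃ c b
      simp [a, c, z, z']
    · obtain ⟨hv, -⟩ := mulPair_eq_of_merge hvw.symm h₂ h₁ h₃' h₃ c b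
      exact absurd a hv
    · simp only [a, b, c, d, if_true, if_false]
  · obtain ⟨c, z, z'⟩ := mulPair_eq_zero_of_split hvw h₂ h₃' a d
    simp [a, c, z, z']
  · obtain ⟨c, b, e⟩ := mulPair_eq_of_merge hvw h₁ h₂ h₃ h₃' a d
    simp only [a, b, c, d, if_true, if_false, e]
  · by_cases c : Γ.circle₁ σ w = Γ.circle₂ σ w <;>
      by_cases b : Γ.circle₁ σ₁ w = Γ.circle₂ σ₁ w
    · simp only [a, b, c, d, if_true, if_false]
    · obtain ⟨hv, -⟩ := mulPair_eq_zero_of_split hvw.symm h₁ h₃ c b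
      exact absurd hv a
    · obtain ⟨-, hd, e⟩ := mulPair_eq_of_merge hvw.symm h₂ h₁ h₃' h₃ c b
      exact absurd hd d
    · simp only [a, b, c, d, if_false]

/-- Three saddles at the same vertex compose to zero. -/
theorem saddle_saddle_saddle (h₁ : σ₁ = flip σ v) (f : Γ.Labeling σ → ZMod 2) :
    saddle Γ v σ σ₁ (saddle Γ v σ₁ σ (saddle Γ v σ σ₁ f)) = 0 := by
  classical
  have h₂ : σ = flip σ₁ v := by rw [h₁, flip_flip]
  suffices h : saddle Γ v σ σ₁ ∘ₗ saddle Γ v σ₁ σ ∘ₗ saddle Γ v σ σ₁ = 0 from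
    LinearMap.congr_fun h f
  refine linearMap_ext_unit (fun α f => ?_) (fun α f => ?_) ?_
  · simp only [LinearMap.comp_apply, saddle_mulX' h₁, saddle_mulX' h₂]
  · simp
  -- Starting from one circle that splits, the unit ends at `(x + x')² = 0`; starting from two
  -- circles, it ends at `x + x = 0` on the merged circle.
  by_cases a : Γ.circle₁ σ v = Γ.circle₂ σ v
  · by_cases b : Γ.circle₁ σ₁ v = Γ.circle₂ σ₁ v
    · simp [LinearMap.comp_apply, saddle_unit h₁, a, mulPair_of_eq b]
    · simp [LinearMap.comp_apply, saddle_unit h₁, saddle_unit h₂, saddle_mulPair h₁,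
        saddle_mulPair h₂, a, b, mulPair_mulPair]
  · have b : Γ.circle₁ σ₁ v = Γ.circle₂ σ₁ v := by
      subst h₁; exact (circle₁_eq_circle₂_or_flip σ v).resolve_left a
    simp [LinearMap.comp_apply, saddle_unit h₁, saddle_unit h₂, saddle_mulPair h₁, a, b,
      mulPair_of_eq b]

/-! ## Saddles lower the degree by one -/

/-- The circles away from `v` correspond bijectively for the two smoothings; a chosen arc on each
circle gives the bijection. -/
theorem sum_deg_eq_of_agree {ρ : Γ.Labeling σ} {ρ' : Γ.Labeling (flip σ v)}
    (h : Agree v ρ ρ') [DecidableEq (Γ.Circle σ)] [DecidableEq (Γ.Circle (flip σ v))] :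
    ∑ C ∈ Finset.univ \ {Γ.circle₁ σ v, Γ.circle₂ σ v}, (ρ C).deg =
      ∑ C ∈ Finset.univ \ {Γ.circle₁ (flip σ v) v, Γ.circle₂ (flip σ v) v}, (ρ' C).deg := by
  have hr : ∀ C, Γ.circleOf σ (Function.surjInv (circleOf_surjective σ) C) = C :=
    Function.surjInv_eq (circleOf_surjective σ)
  set r := Function.surjInv (circleOf_surjective (Γ := Γ) σ)
  have hm : ∀ C ∈ Finset.univ \ {Γ.circle₁ σ v, Γ.circle₂ σ v}, ¬ Meets σ v (r C) := by
    intro C hC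
    simpa [Meets, hr] using hC
  refine Finset.sum_bij (fun C _ => Γ.circleOf (flip σ v) (r C)) (fun C hC => ?_)
    (fun C hC D hD e => ?_) (fun C hC => ?_) (fun C hC => ?_)
  · simpa [Meets] using mt (meets_flip_iff σ v (r C)).mp (hm C hC)
  · rwa [circleOf_flip_eq_iff (hm D hD), hr, hr] at e
  · obtain ⟨α, rfl⟩ := circleOf_surjective _ C
    have hα : ¬ Meets σ v α := mt (meets_flip_iff σ v α).mpr (by simpa [Meets] using hC)
    exact ⟨Γ.circleOf σ α, by simpa [Meets] using hα, (circleOf_flip_eq_iff hα _).mpr (hr _)⟩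
  · rw [h (r C) (hm C hC), hr]

theorem sum_deg_of_saddleCoeff_ne_zero (h₁ : σ₁ = flip σ v) {ρ : Γ.Labeling σ}
    {ρ' : Γ.Labeling σ₁} (h : Γ.saddleCoeff v σ σ₁ ρ ρ' ≠ 0) :
    ∑ C, (ρ' C).deg = ∑ C, (ρ C).deg - 1 := by
  classical
  subst h₁
  rw [← Finset.sum_sdiff (Finset.subset_univ {Γ.circle₁ σ v, Γ.circle₂ σ v}),
    ← Finset.sum_sdiff (Finset.subset_univ {Γ.circle₁ (flip σ v) v, Γ.circle₂ (flip σ v) v})]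
  by_cases a : Γ.circle₁ σ v = Γ.circle₂ σ v
  · by_cases b : Γ.circle₁ (flip σ v) v = Γ.circle₂ (flip σ v) v
    · simp [saddleCoeff_eq, a, b] at h
    rw [saddleCoeff_of_split a b] at h
    split_ifs at h with hA
    swap
    · exact absurd rfl h
    rw [sum_deg_eq_of_agree hA, Finset.sum_pair b, ← a, Finset.pair_eq_singleton,
      Finset.sum_singleton]
    revert h
    generalize ρ (Γ.circle₁ σ v) = p
    generalize ρ' (Γ.circle₁ (flip σ v) v) = q
    generalize ρ' (Γ.circle₂ (flip σ v) v) = r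
    have : Label.comulCoeff p q r ≠ 0 → q.deg + r.deg = p.deg - 1 := by
      revert p q r
      decide
    intro h
    linarith [this h]
  · have b := (circle₁_eq_circle₂_or_flip σ v).resolve_left a
    rw [saddleCoeff_of_merge a b] at h
    split_ifs at h with hA
    swap
    · exact absurd rfl h
    rw [sum_deg_eq_of_agree hA, Finset.sum_pair a, ← b, Finset.pair_eq_singleton,
      Finset.sum_singleton]
    revert h
    generalize ρ (Γ.circle₁ σ v) = p
    generalize ρ (Γ.circle₂ σ v) = q
    generalize ρ' (Γ.circle₁ (flip σ v) v) = r
    have : Label.mulCoeff p q r ≠ 0 → r.deg = p.deg + q.deg - 1 := by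
      revert p q r
      decide
    intro h
    linarith [this h]

theorem sum_deg_of_genusCoeff_ne_zero (h₁ : σ₁ = σ) {ρ : Γ.Labeling σ}
    {ρ' : Γ.Labeling σ₁} (h : Γ.genusCoeff v σ σ₁ ρ ρ' ≠ 0) :
    ∑ C, (ρ' C).deg = ∑ C, (ρ C).deg - 2 := by
  obtain ⟨τ, -, hτ⟩ := Finset.exists_ne_zero_of_sum_ne_zero h
  have e1 := sum_deg_of_saddleCoeff_ne_zero rfl (left_ne_zero_of_mul hτ)
  have e2 := sum_deg_of_saddleCoeff_ne_zero (by rw [h₁, flip_flip]) (right_ne_zero_of_mul hτ)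
  linarith

end Commute

end OrientedGraph

/-! ## The genus-one maps as linear maps -/

namespace OrientedGraph

theorem smoothing_eq_flip_erase {V : Type*} [DecidableEq V] {v : V} (ε : V → Bool)
    {s : Finset V} (h : v ∈ s) :
    smoothing ε s = flip (smoothing ε (s.erase v)) v := by
  funext w
  by_cases hw : w = v
  · subst hw; simp [smoothing, flip_apply_self, h]
  · simp [smoothing, flip_apply_of_ne _ hw, hw]

section Genus

variable {V : Type*} [DecidableEq V] [Finite V] {Γ : OrientedGraph V}
  {σ σ₁ σ₂ σ₃ : V → Bool} {v w : V}

/-- The genus-one cobordism at `v` as a linear map. -/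
def genus (Γ : OrientedGraph V) (v : V) (σ σ' : V → Bool) :
    (Γ.Labeling σ → ZMod 2) →ₗ[ZMod 2] (Γ.Labeling σ' → ZMod 2) :=
  saddle Γ v (flip σ v) σ' ∘ₗ saddle Γ v σ (flip σ v)

theorem genus_eq (f : Γ.Labeling σ → ZMod 2) :
    genus Γ v σ σ₁ f = saddle Γ v (flip σ v) σ₁ (saddle Γ v σ (flip σ v) f) := rfl

theorem genus_apply (f : Γ.Labeling σ → ZMod 2) (ρ' : Γ.Labeling σ₁) :
    genus Γ v σ σ₁ f ρ' = ∑ ρ, Γ.genusCoeff v σ σ₁ ρ ρ' * f ρ := by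
  simp only [genus_eq, saddle_apply, genusCoeff, Finset.sum_mul, Finset.mul_sum]
  rw [Finset.sum_comm]
  exact Finset.sum_congr rfl fun _ _ => Finset.sum_congr rfl fun _ _ => by ring

/-- The saddle at `w` is moved past the two saddles at `v` one after the other. -/
theorem saddle_genus_comm (hvw : v ≠ w) (h₁ : σ₁ = σ) (h₂ : σ₂ = flip σ w) (h₃ : σ₃ = σ₂)
    (f : Γ.Labeling σ → ZMod 2) :
    saddle Γ w σ₁ σ₃ (genus Γ v σ σ₁ f) = genus Γ v σ₂ σ₃ (saddle Γ w σ σ₂ f) := by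
  subst h₁ h₃ h₂
  have e : flip (flip σ₁ w) v = flip (flip σ₁ v) w := flip_comm σ₁ hvw.symm
  rw [genus_eq, genus_eq,
    saddle_comm hvw (flip_flip σ₁ v).symm e rfl (flip_flip (flip σ₁ w) v).symm,
    saddle_comm hvw rfl rfl e rfl]

theorem genus_genus_comm (hvw : v ≠ w) (h₁ : σ₁ = σ) (h₂ : σ₂ = σ) (h₃ : σ₃ = σ)
    (f : Γ.Labeling σ → ZMod 2) :
    genus Γ w σ₁ σ₃ (genus Γ v σ σ₁ f) = genus Γ v σ₂ σ₃ (genus Γ w σ σ₂ f) := by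
  subst h₁ h₂ h₃
  rw [genus_eq (v := w), saddle_genus_comm hvw rfl rfl rfl,
    saddle_genus_comm hvw rfl (flip_flip _ w).symm rfl, genus_eq (v := w)]

theorem genus_saddle_self (h₁ : σ₁ = flip σ v) (h₂ : σ₂ = σ₁) (f : Γ.Labeling σ → ZMod 2) :
    genus Γ v σ₁ σ₂ (saddle Γ v σ σ₁ f) = 0 := by
  subst h₂ h₁
  rw [genus_eq, flip_flip]
  exact saddle_saddle_saddle rfl f

theorem saddle_genus_self (h₁ : σ₁ = σ) (h₂ : σ₂ = flip σ v) (f : Γ.Labeling σ → ZMod 2) :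
    saddle Γ v σ₁ σ₂ (genus Γ v σ σ₁ f) = 0 := by
  subst h₁ h₂
  exact saddle_saddle_saddle rfl f

end Genus

end OrientedGraph

/-! ## The differential as a sum over the vertices -/

namespace SingularLinkDiagram

open OrientedGraph

section Moves

variable {V : Type*} [DecidableEq V] (D : SingularLinkDiagram V)

theorem sign_of_mem_doublePoints [Fintype V] {v : V} (h : v ∈ D.doublePoints) (S : Finset V) :
    D.sign S v = decide (v ∈ S) := by
  have : D.kind v = VertexKind.double := by simpa [doublePoints] using h
  simp [sign, this]

theorem sign_erase_of_ne {v w : V} (h : w ≠ v) (S : Finset V) :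
    D.sign (S.erase v) w = D.sign S w := by
  simp [sign, h]

variable [Fintype V]

/-- The 0-smoothing of a positive crossing and the 1-smoothing of a negative one are both the
oriented smoothing. This lets the genus-one map have source and target in different diagrams. -/
theorem smoothing_sign_erase {v : V} {S s : Finset V} (hS : v ∈ S)
    (hv : v ∈ D.doublePoints) (hs : v ∉ s) :
    smoothing (D.sign S) s = smoothing (D.sign (S.erase v)) (insert v s) := by
  funext w
  by_cases hw : w = v
  · subst hw
    simp [smoothing, sign_of_mem_doublePoints D hv, hS, hs]
  · simp [smoothing, sign_erase_of_ne D hw, hw]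

/-- Chains indexed by all sets `S` of vertices and all states, not only by sets `S` of double
points. -/
abbrev Family : Type _ :=
  ∀ S s : Finset V, D.graph.Labeling (smoothing (D.sign S) s) → ZMod 2

/-- The part of the differential that changes the diagram or its state at the vertex `v`. -/
def move (v : V) (F : D.Family) : D.Family := fun S s =>
  if v ∈ s then
    saddle D.graph v (smoothing (D.sign S) (s.erase v)) (smoothing (D.sign S) s)
      (F S (s.erase v))
  else if v ∈ S ∧ v ∈ D.doublePoints then
    genus D.graph v (smoothing (D.sign (S.erase v)) (insert v s)) (smoothing (D.sign S) s)
      (F (S.erase v) (insert v s))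
  else 0

variable {D}

theorem move_of_mem {v : V} (F : D.Family) (S : Finset V) {s : Finset V} (h : v ∈ s) :
    D.move v F S s = saddle D.graph v (smoothing (D.sign S) (s.erase v))
      (smoothing (D.sign S) s) (F S (s.erase v)) := if_pos h

theorem move_of_notMem {v : V} (F : D.Family) {S s : Finset V} (h : v ∉ s)
    (h' : v ∈ S ∧ v ∈ D.doublePoints) :
    D.move v F S s = genus D.graph v (smoothing (D.sign (S.erase v)) (insert v s))
      (smoothing (D.sign S) s) (F (S.erase v) (insert v s)) := by
  rw [move, if_neg h, if_pos h']

theorem move_eq_zero {v : V} (F : D.Family) {S s : Finset V} (h : v ∉ s)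
    (h' : ¬ (v ∈ S ∧ v ∈ D.doublePoints)) : D.move v F S s = 0 := by
  rw [move, if_neg h, if_neg h']

/-- Two successive moves at `v` can only be a saddle followed by the genus-one map or the reverse,
in either case three saddles at `v`. -/
theorem move_move_self (v : V) (F : D.Family) : D.move v (D.move v F) = 0 := by
  funext S s
  change _ = 0
  by_cases hs : v ∈ s
  · have h1 := smoothing_eq_flip_erase (D.sign S) hs
    rw [move_of_mem _ _ hs]
    by_cases hS : v ∈ S ∧ v ∈ D.doublePoints
    · have h2 := smoothing_sign_erase D hS.1 hS.2 (Finset.notMem_erase v s)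
      rw [move_of_notMem _ (Finset.notMem_erase v s) hS]
      exact saddle_genus_self h2 (by rw [h1, h2]) _
    · rw [move_eq_zero _ (Finset.notMem_erase v s) hS, map_zero]
  · by_cases hS : v ∈ S ∧ v ∈ D.doublePoints
    · rw [move_of_notMem _ hs hS, move_of_mem _ _ (Finset.mem_insert_self v s)]
      exact genus_saddle_self (smoothing_eq_flip_erase _ (Finset.mem_insert_self v s))
        (smoothing_sign_erase D hS.1 hS.2 hs) _
    · rw [move_eq_zero _ hs hS]

theorem move_comm_of_mem {v w : V} (hvw : v ≠ w) (F : D.Family) (S : Finset V) {s : Finset V}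
    (hv : v ∈ s) (hw : w ∉ s) :
    D.move v (D.move w F) S s = D.move w (D.move v F) S s := by
  have hw' : w ∉ s.erase v := fun h => hw (Finset.mem_of_mem_erase h)
  have hv' : v ∈ insert w s := Finset.mem_insert_of_mem hv
  rw [move_of_mem _ _ hv]
  by_cases hS : w ∈ S ∧ w ∈ D.doublePoints
  · rw [move_of_notMem _ hw' hS, move_of_notMem _ hw hS, move_of_mem _ _ hv',
      Finset.erase_insert_of_ne hvw.symm]
    refine saddle_genus_comm hvw.symm (smoothing_sign_erase D hS.1 hS.2 hw') ?_
      (smoothing_sign_erase D hS.1 hS.2 hw) _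
    rw [smoothing_eq_flip_erase _ hv', Finset.erase_insert_of_ne hvw.symm]
  · rw [move_eq_zero _ hw' hS, move_eq_zero _ hw hS, map_zero]

theorem move_comm {v w : V} (hvw : v ≠ w) (F : D.Family) :
    D.move v (D.move w F) = D.move w (D.move v F) := by
  funext S s
  by_cases hv : v ∈ s <;> by_cases hw : w ∈ s
  · have hv' : v ∈ s.erase w := Finset.mem_erase.mpr ⟨hvw, hv⟩
    have hw' : w ∈ s.erase v := Finset.mem_erase.mpr ⟨hvw.symm, hw⟩
    rw [move_of_mem _ _ hv, move_of_mem _ _ hw, move_of_mem _ _ hv', move_of_mem _ _ hw',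
      Finset.erase_right_comm]
    refine saddle_comm hvw.symm ?_ ?_ (smoothing_eq_flip_erase _ hv)
      (smoothing_eq_flip_erase _ hw) _
    · rw [smoothing_eq_flip_erase _ hw', Finset.erase_right_comm]
    · exact smoothing_eq_flip_erase _ hv'
  · exact move_comm_of_mem hvw F S hv hw
  · exact (move_comm_of_mem hvw.symm F S hw hv).symm
  · have hv' : v ∉ insert w s := by simp [hvw, hv]
    have hw' : w ∉ insert v s := by simp [hvw.symm, hw]
    by_cases hSv : v ∈ S ∧ v ∈ D.doublePoints <;> by_cases hSw : w ∈ S ∧ w ∈ D.doublePoints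
    · have hSv' : v ∈ S.erase w ∧ v ∈ D.doublePoints :=
        ⟨Finset.mem_erase.mpr ⟨hvw, hSv.1⟩, hSv.2⟩
      have hSw' : w ∈ S.erase v ∧ w ∈ D.doublePoints :=
        ⟨Finset.mem_erase.mpr ⟨hvw.symm, hSw.1⟩, hSw.2⟩
      have e1 := smoothing_sign_erase D hSv.1 hSv.2 hv
      have e2 := smoothing_sign_erase D hSw.1 hSw.2 hw
      have e3 := smoothing_sign_erase D hSv'.1 hSv'.2 hv'
      rw [move_of_notMem _ hv hSv, move_of_notMem _ hw hSw, move_of_notMem _ hv' hSv',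
        move_of_notMem _ hw' hSw', Finset.erase_right_comm, Finset.insert_comm]
      exact genus_genus_comm hvw.symm (by rw [← e1, e2, e3]) e3 (by rw [e2, e3]) _
    · rw [move_of_notMem _ hv hSv, move_eq_zero _ hw hSw, move_eq_zero _ hw', map_zero]
      exact fun h => hSw ⟨Finset.mem_of_mem_erase h.1, h.2⟩
    · rw [move_of_notMem _ hw hSw, move_eq_zero _ hv hSv, move_eq_zero _ hv', map_zero]
      exact fun h => hSv ⟨Finset.mem_of_mem_erase h.1, h.2⟩
    · rw [move_eq_zero _ hw hSw, move_eq_zero _ hv hSv]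

theorem move_add (v : V) (F G : D.Family) : D.move v (F + G) = D.move v F + D.move v G := by
  funext S s
  simp only [move, Pi.add_apply, map_add]
  split_ifs <;> simp

/-- The sum of the moves at all vertices. -/
def totalMove (D : SingularLinkDiagram V) (F : D.Family) : D.Family := ∑ v, D.move v F

theorem totalMove_totalMove (F : D.Family) : D.totalMove (D.totalMove F) = 0 := by
  have hadd : ∀ v, D.move v (∑ w, D.move w F) = ∑ w, D.move v (D.move w F) := fun v =>
    map_sum (AddMonoidHom.mk' (D.move v) (move_add v)) _ _
  simp only [totalMove, hadd]
  rw [← Fintype.sum_prod_type' (f := fun v w => D.move v (D.move w F))]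
  -- The terms for `(v, w)` and `(w, v)` cancel in characteristic two, and the diagonal terms vanish
  -- by `move_move_self`.
  refine Finset.sum_involution (fun p _ => p.swap) (fun p _ => ?_) (fun p _ hp => ?_)
    (fun _ _ => Finset.mem_univ _) (fun p _ => Prod.swap_swap p)
  · by_cases h : p.1 = p.2
    · simp only [Prod.fst_swap, Prod.snd_swap, h, move_move_self, add_zero]
    · rw [Prod.fst_swap, Prod.snd_swap, move_comm h]
      funext S s ρ
      exact CharTwo.add_self_eq_zero _
  · intro h
    have : p.1 = p.2 := congrArg Prod.snd h
    exact hp (by rw [this, move_move_self])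

end Moves

end SingularLinkDiagram

/-! ## The Khovanov chains form a complex -/

namespace SingularLinkDiagram

open OrientedGraph

section Complex

variable {V : Type*} [DecidableEq V] [Fintype V] {D : SingularLinkDiagram V}

/-- The chain given by a family. -/
def ofFamily (F : D.Family) : D.Chain := fun g => F g.S g.enh.state g.enh.label

/-- Extending by zero to sets `S` containing other vertices transfers identities for families to
chains. -/
theorem ofFamily_surjective : Function.Surjective (ofFamily (D := D)) := by
  intro f
  exact ⟨fun S s ρ => if h : S ⊆ D.doublePoints then f ⟨S, h, ⟨s, ρ⟩⟩ else 0,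
    funext fun g => dif_pos g.subset⟩

theorem sum_generators_eq {S : Finset V} (hS : S ⊆ D.doublePoints) (s : Finset V)
    (k : D.Generator → ZMod 2) (hk : ∀ g, k g ≠ 0 → g.S = S ∧ g.enh.state = s) :
    ∑ g, k g = ∑ ρ, k ⟨S, hS, ⟨s, ρ⟩⟩ := by
  symm
  refine Fintype.sum_of_injective (fun ρ => (⟨S, hS, ⟨s, ρ⟩⟩ : D.Generator)) ?_ _ _ ?_ fun _ => rfl
  · intro ρ ρ' h
    simpa using h
  · rintro ⟨S', hS', ⟨s', ρ⟩⟩ hg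
    by_contra hne
    obtain ⟨rfl, rfl⟩ := hk _ hne
    exact hg ⟨ρ, rfl⟩

/-- The part of the matrix coefficient of the differential at the vertex `v`. -/
def moveCoeff (v : V) (g g' : D.Generator) : ZMod 2 :=
  (if g'.S = g.S ∧ v ∉ g.enh.state ∧ g'.enh.state = insert v g.enh.state then
    saddleCoeff D.graph v _ _ g.enh.label g'.enh.label else 0) +
  (if (v ∈ D.doublePoints ∧ v ∉ g.S ∧ g'.S = insert v g.S) ∧
      v ∈ g.enh.state ∧ g'.enh.state = g.enh.state.erase v then
    genusCoeff D.graph v _ _ g.enh.label g'.enh.label else 0)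

theorem dCoeff_eq_sum (g g' : D.Generator) : D.dCoeff g g' = ∑ v, moveCoeff v g g' := by
  have hsum : ∀ (t : Finset V) (k : V → ZMod 2),
      ∑ c ∈ t, k c = ∑ c, if c ∈ t then k c else 0 := fun t k => by simp
  simp only [dCoeff, moveCoeff, Finset.sum_add_distrib, diffCoeff, genusMapCoeff]
  rw [hsum (Finset.univ \ _), hsum (D.doublePoints \ _)]
  congr 1
  · by_cases hS : g'.S = g.S
    · simp only [hS, if_true, true_and, Finset.mem_sdiff, Finset.mem_univ, ite_and]
    · simp [hS]
  · simp only [Finset.mem_sdiff, ite_and]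

/-- The target determines the pair `(S, s)` of the source, so the sum over generators collapses to a
sum over labelings of one smoothing. -/
theorem sum_moveCoeff_mul (v : V) (F : D.Family) (g' : D.Generator) :
    ∑ g, moveCoeff v g g' * ofFamily F g = ofFamily (D.move v F) g' := by
  obtain ⟨S, hS, ⟨s, ρ'⟩⟩ := g'
  change _ = D.move v F S s ρ'
  simp only [moveCoeff]
  by_cases hs : v ∈ s
  · rw [move_of_mem _ _ hs, sum_generators_eq hS (s.erase v), saddle_apply]
    · refine Finset.sum_congr rfl fun ρ _ => ?_
      simp [hs, ofFamily]
    · rintro ⟨T, hT, ⟨t, τ⟩⟩ hg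
      have h := left_ne_zero_of_mul hg
      dsimp only at h ⊢
      rw [if_neg (c := _ ∧ _ ∧ s = t.erase v), add_zero] at h
      · obtain ⟨⟨rfl, ht, rfl⟩, -⟩ := ite_ne_right_iff.mp h
        exact ⟨rfl, (Finset.erase_insert ht).symm⟩
      · rintro ⟨-, -, rfl⟩
        exact Finset.notMem_erase v t hs
  · by_cases hS' : v ∈ S ∧ v ∈ D.doublePoints
    · rw [move_of_notMem _ hs hS', sum_generators_eq ((Finset.erase_subset v S).trans hS)
        (insert v s), genus_apply]
      · refine Finset.sum_congr rfl fun ρ _ => ?_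
        simp [hs, hS', ofFamily]
      · rintro ⟨T, hT, ⟨t, τ⟩⟩ hg
        have h := left_ne_zero_of_mul hg
        dsimp only at h ⊢
        rw [if_neg (c := _ ∧ _ ∧ s = insert v t), zero_add] at h
        · obtain ⟨⟨⟨-, hT, rfl⟩, ht, rfl⟩, -⟩ := ite_ne_right_iff.mp h
          exact ⟨(Finset.erase_insert hT).symm, (Finset.insert_erase ht).symm⟩
        · rintro ⟨-, -, rfl⟩
          exact hs (Finset.mem_insert_self v t)
    · rw [move_eq_zero _ hs hS']
      refine Finset.sum_eq_zero fun g _ => ?_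
      rw [if_neg, if_neg]
      · simp
      · rintro ⟨⟨h, -, rfl⟩, -⟩
        exact hS' ⟨Finset.mem_insert_self v g.S, h⟩
      · rintro ⟨-, -, rfl⟩
        exact hs (Finset.mem_insert_self v _)

theorem d_ofFamily (F : D.Family) : D.d (ofFamily F) = ofFamily (D.totalMove F) := by
  funext g'
  change ∑ g, D.dCoeff g g' * ofFamily F g = _
  simp only [dCoeff_eq_sum, Finset.sum_mul]
  rw [Finset.sum_comm]
  simp only [sum_moveCoeff_mul]
  simp [ofFamily, totalMove, Finset.sum_apply]

theorem d_comp_d (D : SingularLinkDiagram V) : D.d ∘ₗ D.d = 0 := by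
  ext1 f
  obtain ⟨F, rfl⟩ := ofFamily_surjective f
  rw [LinearMap.comp_apply, d_ofFamily, d_ofFamily, totalMove_totalMove]
  rfl

/-! ### Bidegree of the differential -/

theorem nPos_insert {v : V} (hv : v ∈ D.doublePoints) {S : Finset V} (h : v ∉ S) :
    D.nPos (insert v S) = D.nPos S + 1 := by
  rw [nPos, nPos, ← Finset.card_erase_add_one (a := v)]
  · congr 2
    ext w
    by_cases hw : w = v
    · subst hw; simp [sign_of_mem_doublePoints D hv, h]
    · simp [hw, ← sign_erase_of_ne D hw (insert v S), Finset.erase_insert h]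
  · simp [sign_of_mem_doublePoints D hv]

theorem nNeg_insert {v : V} (hv : v ∈ D.doublePoints) {S : Finset V} (h : v ∉ S) :
    D.nNeg S = D.nNeg (insert v S) + 1 := by
  rw [nNeg, nNeg, ← Finset.card_erase_add_one (a := v)]
  · congr 2
    ext w
    by_cases hw : w = v
    · subst hw; simp [sign_of_mem_doublePoints D hv]
    · simp [hw, ← sign_erase_of_ne D hw (insert v S), Finset.erase_insert h]
  · simp [sign_of_mem_doublePoints D hv, h]

theorem degrees_of_moveCoeff_ne_zero {v : V} {g g' : D.Generator} (h : moveCoeff v g g' ≠ 0) :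
    g'.hdeg = g.hdeg + 1 ∧ g'.qdeg = g.qdeg := by
  obtain ⟨S, hS, ⟨s, ρ⟩⟩ := g
  obtain ⟨S', hS', ⟨s', ρ'⟩⟩ := g'
  simp only [moveCoeff] at h
  simp only [Generator.hdeg, Generator.qdeg, EnhancedState.deg]
  by_cases h1 : S' = S ∧ v ∉ s ∧ s' = insert v s
  · obtain ⟨rfl, hs, rfl⟩ := h1
    have h2 : ¬ (v ∈ D.doublePoints ∧ v ∉ S' ∧ S' = insert v S') := by
      rintro ⟨-, h, e⟩
      exact h (e ▸ Finset.mem_insert_self v S')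
    rw [if_pos ⟨rfl, hs, rfl⟩, if_neg (fun h => h2 h.1), add_zero] at h
    have e : smoothing (D.sign S') (insert v s) = flip (smoothing (D.sign S') s) v := by
      rw [smoothing_eq_flip_erase _ (Finset.mem_insert_self v s), Finset.erase_insert hs]
    rw [sum_deg_of_saddleCoeff_ne_zero e h, Finset.card_insert_of_notMem hs]
    push_cast
    constructor <;> ring
  · rw [if_neg h1, zero_add] at h
    obtain ⟨⟨⟨hv, hS, rfl⟩, hs, rfl⟩, h⟩ := ite_ne_right_iff.mp h
    have e := smoothing_sign_erase D (Finset.mem_insert_self v S) hv (Finset.notMem_erase v s)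
    rw [Finset.insert_erase hs, Finset.erase_insert hS] at e
    have hd : (D.doublePoints \ S).card = (D.doublePoints \ insert v S).card + 1 := by
      rw [Finset.sdiff_insert, Finset.card_erase_add_one]
      simp [hv, hS]
    have hc := Finset.card_erase_add_one hs
    -- The label degree falls by 2 and the state size by 1, while `nPos - 2 * nNeg` rises by 3. In
    -- homological degree, -1 from the state is offset by +1 from `nNeg` and +1 from the cone shift.
    rw [sum_deg_of_genusCoeff_ne_zero e h, nPos_insert hv hS, nNeg_insert hv hS, hd, ← hc]
    push_cast
    constructor <;> ring

theorem degrees_of_dCoeff_ne_zero {g g' : D.Generator} (h : D.dCoeff g g' ≠ 0) :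
    g'.hdeg = g.hdeg + 1 ∧ g'.qdeg = g.qdeg := by
  rw [dCoeff_eq_sum] at h
  obtain ⟨v, -, hv⟩ := Finset.exists_ne_zero_of_sum_ne_zero h
  exact degrees_of_moveCoeff_ne_zero hv

theorem d_mem_chain {i j : ℤ} {f : D.Chain} (hf : f ∈ D.chain i j) : D.d f ∈ D.chain (i + 1) j := by
  intro g' hg'
  obtain ⟨g, -, hg⟩ := Finset.exists_ne_zero_of_sum_ne_zero
    (show ∑ g, D.dCoeff g g' * f g ≠ 0 from hg')
  obtain ⟨h1, h2⟩ := degrees_of_dCoeff_ne_zero (left_ne_zero_of_mul hg)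
  obtain ⟨rfl, rfl⟩ := hf g (right_ne_zero_of_mul hg)
  exact ⟨h1, h2⟩

theorem isComplex (D : SingularLinkDiagram V) : D.IsComplex :=
  ⟨d_comp_d D, fun _ _ => Submodule.map_le_iff_le_comap.mpr fun _ => d_mem_chain⟩

end Complex

end SingularLinkDiagram

/-! ## The resolutions of a double point -/

namespace OrientedGraph

section Cast

variable {V : Type*} {Γ : OrientedGraph V} {ε₁ ε₂ ε₃ ε₄ : V → Bool} [DecidableEq V]

/-- Enhanced states of the same diagram. -/
def EnhancedState.cast (h : ε₁ = ε₂) (e : Γ.EnhancedState ε₁) : Γ.EnhancedState ε₂ := h ▸ e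

theorem EnhancedState.cast_cast (h : ε₁ = ε₂) (h' : ε₂ = ε₁) (e : Γ.EnhancedState ε₁) :
    (e.cast h).cast h' = e := by
  subst h; rfl

theorem EnhancedState.cast_injective (h : ε₁ = ε₂) :
    Function.Injective (EnhancedState.cast (Γ := Γ) h) :=
  Function.LeftInverse.injective fun e => e.cast_cast h h.symm

theorem EnhancedState.state_cast (h : ε₁ = ε₂) (e : Γ.EnhancedState ε₁) :
    (e.cast h).state = e.state := by
  subst h; rfl

theorem EnhancedState.deg_cast [Finite V] (h : ε₁ = ε₂) (e : Γ.EnhancedState ε₁) :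
    (e.cast h).deg = e.deg := by
  subst h; rfl

theorem insert_inj_of_notMem {b : V} {S T : Finset V} (hS : b ∉ S) (hT : b ∉ T) :
    insert b S = insert b T ↔ S = T :=
  ⟨fun e => by rw [← Finset.erase_insert hS, e, Finset.erase_insert hT], fun e => by rw [e]⟩

variable [Fintype V]

/-- The matrix coefficient of the differential of the multiple mapping cone of the cube indexed by
the subsets of `P`, from the vertex `S` to the vertex `S'`. -/
def coneCoeff (P S S' : Finset V) (e : Γ.EnhancedState ε₁) (e' : Γ.EnhancedState ε₂) : ZMod 2 :=
  (if S' = S then diffCoeff e e' else 0) +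
    ∑ c ∈ P \ S, if S' = insert c S then genusMapCoeff c e e' else 0

/-- `coneCoeff` has the signs as free variables, so equalities of signs can be eliminated; `dCoeff`
for `D` and for its resolutions are instances of it. -/
theorem coneCoeff_cast (P S S' : Finset V) (h : ε₁ = ε₂) (h' : ε₃ = ε₄)
    (e : Γ.EnhancedState ε₁) (e' : Γ.EnhancedState ε₃) :
    coneCoeff P S S' (e.cast h) (e'.cast h') = coneCoeff P S S' e e' := by
  subst h h'; rfl

variable {b : V} (P : Finset V) {S S' : Finset V} (e : Γ.EnhancedState ε₁)
  (e' : Γ.EnhancedState ε₂)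

theorem coneCoeff_erase (hS' : b ∉ S') :
    coneCoeff P S S' e e' = coneCoeff (P.erase b) S S' e e' := by
  rw [coneCoeff, coneCoeff, Finset.erase_sdiff_comm, Finset.sum_erase]
  refine if_neg fun h => hS' ?_
  rw [h]
  exact Finset.mem_insert_self _ _

theorem coneCoeff_insert_insert (hS : b ∉ S) (hS' : b ∉ S') :
    coneCoeff P (insert b S) (insert b S') e e' = coneCoeff (P.erase b) S S' e e' := by
  rw [coneCoeff, coneCoeff, Finset.sdiff_insert, Finset.erase_sdiff_comm]
  simp only [insert_inj_of_notMem hS' hS]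
  congr 1
  refine Finset.sum_congr rfl fun c hc => ?_
  have hcb : b ∉ insert c S := by
    simp only [Finset.mem_sdiff, Finset.mem_erase] at hc
    simp [hS, hc.1.symm]
  simp only [Finset.insert_comm c b, insert_inj_of_notMem hS' hcb]

/-- No edge of the cube removes `b` from `S`; this is the zero block of the cone. -/
theorem coneCoeff_insert_left (hS' : b ∉ S') : coneCoeff P (insert b S) S' e e' = 0 := by
  rw [coneCoeff, if_neg, zero_add]
  · refine Finset.sum_eq_zero fun c _ => if_neg fun h => hS' ?_
    simp [h]
  · exact fun h => hS' (h ▸ Finset.mem_insert_self _ _)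

theorem coneCoeff_insert_right (hb : b ∈ P) (hS : b ∉ S) (hS' : b ∉ S') :
    coneCoeff P S (insert b S') e e' = if S' = S then genusMapCoeff b e e' else 0 := by
  rw [coneCoeff, if_neg, zero_add, Finset.sum_eq_single b]
  · simp only [insert_inj_of_notMem hS' hS]
  · intro c _ hc
    refine if_neg fun h => ?_
    have : b ∈ insert c S := h ▸ Finset.mem_insert_self _ _
    simp [hS, Ne.symm hc] at this
  · intro h
    simp [hS, hb] at h
  · exact fun h => hS (h ▸ Finset.mem_insert_self _ _)

end Cast

end OrientedGraph

namespace SingularLinkDiagram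

open OrientedGraph

section Resolve

theorem mem_doublePoints_iff {V : Type*} [Fintype V] {D : SingularLinkDiagram V} {v : V} :
    v ∈ D.doublePoints ↔ D.kind v = VertexKind.double := by
  simp [doublePoints]

variable {V : Type*} [DecidableEq V] {D : SingularLinkDiagram V} {b : V}
  (hb : D.kind b = VertexKind.double)

theorem sign_resolve_negative (hb : D.kind b = VertexKind.double) {S : Finset V} (h : b ∉ S) :
    (D.resolve b VertexKind.negative).sign S = D.sign S := by
  funext w
  by_cases hw : w = b
  · subst hw; simp [sign, resolve, hb, h]
  · simp [sign, resolve, hw]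

theorem sign_resolve_positive (hb : D.kind b = VertexKind.double) (S : Finset V) :
    (D.resolve b VertexKind.positive).sign S = D.sign (insert b S) := by
  funext w
  by_cases hw : w = b
  · subst hw; simp [sign, resolve, hb]
  · simp [sign, resolve, hw]

variable [Fintype V]

theorem doublePoints_resolve {k : VertexKind} (hk : k ≠ VertexKind.double) :
    (D.resolve b k).doublePoints = D.doublePoints.erase b := by
  ext w
  rw [Finset.mem_erase, mem_doublePoints_iff, mem_doublePoints_iff]
  change Function.update D.kind b k w = _ ↔ _
  by_cases hw : w = b
  · subst hw; simp [hk]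
  · simp [hw]

theorem notMem_of_resolve {k : VertexKind} (hk : k ≠ VertexKind.double)
    (g : (D.resolve b k).Generator) : b ∉ g.S := fun h => by
  simpa [doublePoints_resolve hk] using g.subset h

theorem subset_of_resolve {k : VertexKind} (hk : k ≠ VertexKind.double)
    (g : (D.resolve b k).Generator) : g.S ⊆ D.doublePoints :=
  g.subset.trans (by rw [doublePoints_resolve hk]; exact Finset.erase_subset _ _)

/-- A generator for the negative resolution as a generator for the double point. -/
def Generator.ofNegative (g : (D.resolve b VertexKind.negative).Generator) : D.Generator where
  S := g.S
  subset := subset_of_resolve (by decide) g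
  enh := g.enh.cast (sign_resolve_negative hb (notMem_of_resolve (by decide) g))

/-- A generator for the positive resolution as a generator for the double point. -/
def Generator.ofPositive (g : (D.resolve b VertexKind.positive).Generator) : D.Generator where
  S := insert b g.S
  subset := Finset.insert_subset (mem_doublePoints_iff.mpr hb) (subset_of_resolve (by decide) g)
  enh := g.enh.cast (sign_resolve_positive hb g.S)

theorem Generator.ofNegative_injective :
    Function.Injective (Generator.ofNegative (D := D) hb) := by
  rintro ⟨S, hS, e⟩ ⟨S', hS', e'⟩ h
  obtain ⟨rfl, h⟩ := (Generator.mk.injEq ..).mp h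
  obtain rfl : e = e' := EnhancedState.cast_injective _ (eq_of_heq h)
  rfl

theorem Generator.ofPositive_injective :
    Function.Injective (Generator.ofPositive (D := D) hb) := by
  intro g g' h
  have hg := notMem_of_resolve (by decide) g
  have hg' := notMem_of_resolve (by decide) g'
  obtain ⟨S, hS, e⟩ := g
  obtain ⟨S', hS', e'⟩ := g'
  obtain ⟨hSS, h⟩ := (Generator.mk.injEq ..).mp h
  obtain rfl := (insert_inj_of_notMem hg hg').mp hSS
  obtain rfl : e = e' := EnhancedState.cast_injective _ (eq_of_heq h)
  rfl

/-- A set `S` of double points of `D` either omits `b`, or is `insert b T` for a unique `T` that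
omits `b`. -/
theorem Generator.sum_bijective : Function.Bijective
    (Sum.elim (Generator.ofNegative (D := D) hb) (Generator.ofPositive (D := D) hb)) := by
  constructor
  · refine (Generator.ofNegative_injective hb).sumElim (Generator.ofPositive_injective hb) ?_
    intro g g' h
    have : g.S = insert b g'.S := congrArg Generator.S h
    exact notMem_of_resolve (by decide) g (this ▸ Finset.mem_insert_self _ _)
  · rintro ⟨S, hS, e⟩
    by_cases h : b ∈ S
    · obtain ⟨T, hT, rfl⟩ : ∃ T, b ∉ T ∧ insert b T = S :=
        ⟨S.erase b, Finset.notMem_erase b S, Finset.insert_erase h⟩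
      refine ⟨Sum.inr ⟨T, ?_, e.cast (sign_resolve_positive hb T).symm⟩, ?_⟩
      · rw [doublePoints_resolve (by decide), ← Finset.erase_insert hT]
        exact Finset.erase_subset_erase b hS
      · exact congrArg (Generator.mk _ hS) (EnhancedState.cast_cast _ _ e)
    · refine ⟨Sum.inl ⟨S, ?_, e.cast (sign_resolve_negative hb h).symm⟩, ?_⟩
      · rw [doublePoints_resolve (by decide)]
        exact Finset.subset_erase.mpr ⟨hS, h⟩
      · exact congrArg (Generator.mk _ hS) (EnhancedState.cast_cast _ _ e)

/-- The generators for the double point are those for its two resolutions. -/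
def generatorEquiv : (D.resolve b VertexKind.negative).Generator ⊕
    (D.resolve b VertexKind.positive).Generator ≃ D.Generator :=
  Equiv.ofBijective _ (Generator.sum_bijective hb)

theorem state_ofNegative (g : (D.resolve b VertexKind.negative).Generator) :
    (g.ofNegative hb).enh.state = g.enh.state := EnhancedState.state_cast _ _

theorem deg_ofNegative (g : (D.resolve b VertexKind.negative).Generator) :
    (g.ofNegative hb).enh.deg = g.enh.deg := EnhancedState.deg_cast _ _

theorem state_ofPositive (g : (D.resolve b VertexKind.positive).Generator) :
    (g.ofPositive hb).enh.state = g.enh.state := EnhancedState.state_cast _ _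

theorem deg_ofPositive (g : (D.resolve b VertexKind.positive).Generator) :
    (g.ofPositive hb).enh.deg = g.enh.deg := EnhancedState.deg_cast _ _

theorem nNeg_ofNegative (g : (D.resolve b VertexKind.negative).Generator) :
    D.nNeg (g.ofNegative hb).S = (D.resolve b VertexKind.negative).nNeg g.S := by
  rw [nNeg, nNeg, sign_resolve_negative hb (notMem_of_resolve (by decide) g)]
  rfl

theorem nPos_ofNegative (g : (D.resolve b VertexKind.negative).Generator) :
    D.nPos (g.ofNegative hb).S = (D.resolve b VertexKind.negative).nPos g.S := by
  rw [nPos, nPos, sign_resolve_negative hb (notMem_of_resolve (by decide) g)]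
  rfl

theorem nNeg_ofPositive (g : (D.resolve b VertexKind.positive).Generator) :
    D.nNeg (g.ofPositive hb).S = (D.resolve b VertexKind.positive).nNeg g.S := by
  rw [nNeg, nNeg, sign_resolve_positive hb]
  rfl

theorem nPos_ofPositive (g : (D.resolve b VertexKind.positive).Generator) :
    D.nPos (g.ofPositive hb).S = (D.resolve b VertexKind.positive).nPos g.S := by
  rw [nPos, nPos, sign_resolve_positive hb]
  rfl

/-- For `D` the vertex `b` is one more double point outside `S`; this is the shift of the source in
the mapping cone. -/
theorem hdeg_ofNegative (g : (D.resolve b VertexKind.negative).Generator) :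
    (g.ofNegative hb).hdeg = g.hdeg - 1 := by
  have hg := notMem_of_resolve (by decide) g
  have h : (D.doublePoints \ g.S).card =
      ((D.resolve b VertexKind.negative).doublePoints \ g.S).card + 1 := by
    rw [doublePoints_resolve (by decide), Finset.erase_sdiff_comm, Finset.card_erase_add_one]
    simp [hg, mem_doublePoints_iff, hb]
  rw [Generator.hdeg, Generator.hdeg, state_ofNegative, nNeg_ofNegative]
  change _ - ((D.doublePoints \ g.S).card : ℤ) = _
  rw [h]
  push_cast
  ring

theorem qdeg_ofNegative (g : (D.resolve b VertexKind.negative).Generator) :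
    (g.ofNegative hb).qdeg = g.qdeg := by
  rw [Generator.qdeg, Generator.qdeg, state_ofNegative, deg_ofNegative, nNeg_ofNegative,
    nPos_ofNegative]

theorem hdeg_ofPositive (g : (D.resolve b VertexKind.positive).Generator) :
    (g.ofPositive hb).hdeg = g.hdeg := by
  have h : D.doublePoints \ insert b g.S =
      (D.resolve b VertexKind.positive).doublePoints \ g.S := by
    rw [doublePoints_resolve (by decide), Finset.sdiff_insert, Finset.erase_sdiff_comm]
  rw [Generator.hdeg, Generator.hdeg, state_ofPositive, nNeg_ofPositive, ← h]
  rfl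

theorem qdeg_ofPositive (g : (D.resolve b VertexKind.positive).Generator) :
    (g.ofPositive hb).qdeg = g.qdeg := by
  rw [Generator.qdeg, Generator.qdeg, state_ofPositive, deg_ofPositive, nNeg_ofPositive,
    nPos_ofPositive]

/-! ### The blocks of the differential -/

theorem dCoeff_ofNegative_ofNegative (g g' : (D.resolve b VertexKind.negative).Generator) :
    D.dCoeff (g.ofNegative hb) (g'.ofNegative hb) =
      (D.resolve b VertexKind.negative).dCoeff g g' := by
  refine (coneCoeff_cast _ _ _ _ _ _ _).trans
    ((coneCoeff_erase _ _ _ (notMem_of_resolve (by decide) g')).trans ?_)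
  rw [← doublePoints_resolve (k := VertexKind.negative) (by decide)]
  rfl

theorem dCoeff_ofPositive_ofPositive (g g' : (D.resolve b VertexKind.positive).Generator) :
    D.dCoeff (g.ofPositive hb) (g'.ofPositive hb) =
      (D.resolve b VertexKind.positive).dCoeff g g' := by
  refine (coneCoeff_cast _ _ _ _ _ _ _).trans ((coneCoeff_insert_insert _ _ _
    (notMem_of_resolve (by decide) g) (notMem_of_resolve (by decide) g')).trans ?_)
  rw [← doublePoints_resolve (k := VertexKind.positive) (by decide)]
  rfl

theorem dCoeff_ofPositive_ofNegative (g : (D.resolve b VertexKind.positive).Generator)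
    (g' : (D.resolve b VertexKind.negative).Generator) :
    D.dCoeff (g.ofPositive hb) (g'.ofNegative hb) = 0 :=
  coneCoeff_insert_left _ _ _ (notMem_of_resolve (by decide) g')

theorem dCoeff_ofNegative_ofPositive (g : (D.resolve b VertexKind.negative).Generator)
    (g' : (D.resolve b VertexKind.positive).Generator) :
    D.dCoeff (g.ofNegative hb) (g'.ofPositive hb) =
      if g'.S = g.S then genusMapCoeff (Γ := D.graph) b g.enh g'.enh else 0 :=
  (coneCoeff_cast _ _ _ _ _ _ _).trans (coneCoeff_insert_right _ _ _
    (mem_doublePoints_iff.mpr hb) (notMem_of_resolve (by decide) g)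
    (notMem_of_resolve (by decide) g'))

/-- The chains for the double point are pairs of chains for its resolutions. -/
def chainEquiv : D.Chain ≃ₗ[ZMod 2]
    (D.resolve b VertexKind.negative).Chain × (D.resolve b VertexKind.positive).Chain :=
  LinearEquiv.funCongrLeft (ZMod 2) (ZMod 2) (generatorEquiv hb) ≪≫ₗ
    LinearEquiv.sumArrowLequivProdArrow _ _ (ZMod 2) (ZMod 2)

theorem chainEquiv_fst (f : D.Chain) (g : (D.resolve b VertexKind.negative).Generator) :
    (chainEquiv hb f).1 g = f (g.ofNegative hb) := rfl

theorem chainEquiv_snd (f : D.Chain) (g : (D.resolve b VertexKind.positive).Generator) :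
    (chainEquiv hb f).2 g = f (g.ofPositive hb) := rfl

theorem d_apply_eq_add (f : D.Chain) (g' : D.Generator) :
    D.d f g' = ∑ g, D.dCoeff (Generator.ofNegative hb g) g' * (chainEquiv hb f).1 g +
      ∑ g, D.dCoeff (Generator.ofPositive hb g) g' * (chainEquiv hb f).2 g := by
  change ∑ g, D.dCoeff g g' * f g = _
  rw [← Equiv.sum_comp (generatorEquiv hb), Fintype.sum_sum_type]
  rfl

/-- The Khovanov complex of `D` is the mapping cone of the genus-one map. -/
theorem chainEquiv_d (f : D.Chain) :
    chainEquiv hb (D.d f) =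
      ((D.resolve b VertexKind.negative).d (chainEquiv hb f).1,
        D.genusMap b (chainEquiv hb f).1 +
          (D.resolve b VertexKind.positive).d (chainEquiv hb f).2) := by
  refine Prod.ext (funext fun g' => ?_) (funext fun g' => ?_)
  · rw [chainEquiv_fst, d_apply_eq_add hb]
    simp only [dCoeff_ofNegative_ofNegative, dCoeff_ofPositive_ofNegative, zero_mul,
      Finset.sum_const_zero, add_zero]
    rfl
  · rw [chainEquiv_snd, d_apply_eq_add hb]
    simp only [dCoeff_ofNegative_ofPositive, dCoeff_ofPositive_ofPositive]
    rfl

theorem mem_chain_iff_chainEquiv {i j : ℤ} (f : D.Chain) :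
    f ∈ D.chain i j ↔
      (chainEquiv hb f).1 ∈ (D.resolve b VertexKind.negative).chain (i + 1) j ∧
        (chainEquiv hb f).2 ∈ (D.resolve b VertexKind.positive).chain i j := by
  change (∀ g, f g ≠ 0 → g.hdeg = i ∧ g.qdeg = j) ↔
    (∀ g : (D.resolve b VertexKind.negative).Generator,
      f (g.ofNegative hb) ≠ 0 → g.hdeg = i + 1 ∧ g.qdeg = j) ∧
    ∀ g : (D.resolve b VertexKind.positive).Generator,
      f (g.ofPositive hb) ≠ 0 → g.hdeg = i ∧ g.qdeg = j
  rw [← (generatorEquiv hb).forall_congr_right, Sum.forall]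
  refine and_congr (forall_congr' fun g => imp_congr_right fun _ => ?_)
    (forall_congr' fun g => imp_congr_right fun _ => ?_)
  · change (g.ofNegative hb).hdeg = i ∧ (g.ofNegative hb).qdeg = j ↔ _
    rw [hdeg_ofNegative, qdeg_ofNegative, sub_eq_iff_eq_add]
  · change (g.ofPositive hb).hdeg = i ∧ (g.ofPositive hb).qdeg = j ↔ _
    rw [hdeg_ofPositive, qdeg_ofPositive]

/-- With `Φ` the genus-one map, the second component of `d² (x, 0) = 0` in the cone reads `Φ (d x) +
d (Φ x) = 0`. -/
theorem genusMap_comp_d (hb : D.kind b = VertexKind.double) :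
    D.genusMap b ∘ₗ (D.resolve b VertexKind.negative).d =
    (D.resolve b VertexKind.positive).d ∘ₗ D.genusMap b := by
  ext1 x
  obtain ⟨f, hf⟩ := (chainEquiv hb).surjective (x, 0)
  have h : D.d (D.d f) = 0 := LinearMap.congr_fun (d_comp_d D) f
  have h2 := congrArg Prod.snd (congrArg (chainEquiv hb) h)
  rw [chainEquiv_d, chainEquiv_d, hf, map_zero, map_zero, add_zero] at h2
  funext g
  exact CharTwo.add_eq_zero.mp (congrFun h2 g)

theorem genusMap_mem_chain (hb : D.kind b = VertexKind.double) {i j : ℤ}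
    {x : (D.resolve b VertexKind.negative).Chain}
    (hx : x ∈ (D.resolve b VertexKind.negative).chain i j) :
    D.genusMap b x ∈ (D.resolve b VertexKind.positive).chain i j := by
  obtain ⟨f, hf⟩ := (chainEquiv hb).surjective (x, 0)
  -- The source sits one degree lower in the cone, and `d` restores that degree, so `Φ` has degree
  -- zero.
  have hfc : f ∈ D.chain (i - 1) j := by
    rw [mem_chain_iff_chainEquiv hb, hf, sub_add_cancel]
    exact ⟨hx, zero_mem _⟩
  have h := ((mem_chain_iff_chainEquiv hb _).mp (d_mem_chain hfc)).2
  rwa [chainEquiv_d, hf, map_zero, add_zero, sub_add_cancel] at h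

end Resolve

/-! ## The long exact sequence of a mapping cone -/

section LongExact

variable {V : Type*} [DecidableEq V] [Fintype V] {A B C : SingularLinkDiagram V} {i k j : ℤ}

theorem homologyClass_surjective :
    Function.Surjective (homologyClass (D := A) (i := i) (j := j)) :=
  Submodule.Quotient.mk_surjective _

theorem homologyClass_eq_iff (z w : A.cocycles i j) :
    homologyClass z = homologyClass w ↔ ∃ u ∈ A.chain (i - 1) j, A.d u = z - w := by
  rw [homologyClass, homologyClass, Submodule.Quotient.eq]
  rfl

theorem homologyClass_eq_zero_iff (z : A.cocycles i j) :
    homologyClass z = 0 ↔ ∃ u ∈ A.chain (i - 1) j, A.d u = z := by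
  rw [← sub_zero (z : A.Chain), ← ZeroMemClass.coe_zero (A.cocycles i j),
    ← homologyClass_eq_iff]
  rfl

/-- The map on homology induced by a chain map, possibly with a shift. -/
def mapKh (f : A.Chain →ₗ[ZMod 2] B.Chain) (h : ∀ z ∈ A.cocycles i j, f z ∈ B.cocycles k j)
    (h' : ∀ u ∈ A.chain (i - 1) j, ∃ u' ∈ B.chain (k - 1) j, B.d u' = f (A.d u)) :
    A.Kh i j →ₗ[ZMod 2] B.Kh k j :=
  Submodule.mapQ _ _ (f.restrict h) <| by
    rintro ⟨z, hz⟩ ⟨u, hu, rfl⟩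
    exact h' u hu

theorem mapKh_homologyClass {f : A.Chain →ₗ[ZMod 2] B.Chain}
    (h : ∀ z ∈ A.cocycles i j, f z ∈ B.cocycles k j)
    (h' : ∀ u ∈ A.chain (i - 1) j, ∃ u' ∈ B.chain (k - 1) j, B.d u' = f (A.d u))
    (z : A.cocycles i j) :
    mapKh f h h' (homologyClass z) = homologyClass ⟨f z, h z z.2⟩ := rfl

theorem Chain.add_self (x : A.Chain) : x + x = 0 := funext fun _ => CharTwo.add_self_eq_zero _

theorem Chain.add_eq_zero_iff (x y : A.Chain) : x + y = 0 ↔ x = y :=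
  ⟨fun h => by rw [← add_zero x, ← Chain.add_self y, ← add_assoc, h, zero_add],
    fun h => by rw [h, Chain.add_self]⟩

theorem Chain.sub_eq_add (x y : A.Chain) : x - y = x + y := by
  rw [sub_eq_iff_eq_add, add_assoc, Chain.add_self, add_zero]

/-- The maps into and out of the cone `C` are the inclusion of `B` and the projection to `A`. The
identification with the cone makes the connecting map this projection, and exactness is checked on
cocycles. -/
theorem exists_longExact_of_cone (Φ : A.Chain →ₗ[ZMod 2] B.Chain)
    (hΦ : ∀ x, Φ (A.d x) = B.d (Φ x))
    (hΦc : ∀ (i j : ℤ), ∀ x ∈ A.chain i j, Φ x ∈ B.chain i j)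
    (e : C.Chain ≃ₗ[ZMod 2] A.Chain × B.Chain)
    (he : ∀ f, e (C.d f) = (A.d (e f).1, Φ (e f).1 + B.d (e f).2))
    (hec : ∀ (i j : ℤ) (f : C.Chain),
      f ∈ C.chain i j ↔ (e f).1 ∈ A.chain (i + 1) j ∧ (e f).2 ∈ B.chain i j) (j : ℤ) :
    ∃ (φ : ∀ i : ℤ, A.Kh i j →ₗ[ZMod 2] B.Kh i j) (ψ : ∀ i : ℤ, B.Kh i j →ₗ[ZMod 2] C.Kh i j)
      (δ : ∀ i : ℤ, C.Kh i j →ₗ[ZMod 2] A.Kh (i + 1) j),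
      (∀ (i : ℤ) (z : A.cocycles i j) (w : B.cocycles i j), (w : B.Chain) = Φ z →
        φ i (homologyClass z) = homologyClass w) ∧
      (∀ i : ℤ, Function.Exact (φ i) (ψ i)) ∧ (∀ i : ℤ, Function.Exact (ψ i) (δ i)) ∧
      (∀ i : ℤ, Function.Exact (δ i) (φ (i + 1))) := by
  have hs : ∀ x y, C.d (e.symm (x, y)) = e.symm (A.d x, Φ x + B.d y) := fun x y => by
    rw [LinearEquiv.eq_symm_apply, he, LinearEquiv.apply_symm_apply]
  have hsc : ∀ (i : ℤ) x y, e.symm (x, y) ∈ C.chain i j ↔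
      x ∈ A.chain (i + 1) j ∧ y ∈ B.chain i j := fun i x y => by
    rw [hec, LinearEquiv.apply_symm_apply]
  have hcoc : ∀ (i : ℤ) x y, e.symm (x, y) ∈ C.cocycles i j ↔
      (A.d x = 0 ∧ Φ x = B.d y) ∧ x ∈ A.chain (i + 1) j ∧ y ∈ B.chain i j := fun i x y => by
    rw [cocycles, Submodule.mem_inf, LinearMap.mem_ker, hs, LinearEquiv.map_eq_zero_iff,
      Prod.mk_eq_zero, Chain.add_eq_zero_iff, hsc]
  have hφ : ∀ i, ∀ z ∈ A.cocycles i j, Φ z ∈ B.cocycles i j := fun i z hz =>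
    ⟨LinearMap.mem_ker.mpr (by rw [← hΦ, LinearMap.mem_ker.mp hz.1, map_zero]), hΦc i j z hz.2⟩
  have hφ' : ∀ i, ∀ u ∈ A.chain (i - 1) j, ∃ u' ∈ B.chain (i - 1) j, B.d u' = Φ (A.d u) :=
    fun i u hu => ⟨Φ u, hΦc _ j u hu, (hΦ u).symm⟩
  let ι : B.Chain →ₗ[ZMod 2] C.Chain := e.symm.toLinearMap ∘ₗ LinearMap.inr (ZMod 2) _ _
  have hι : ∀ y, ι y = e.symm (0, y) := fun _ => rfl
  have hψ : ∀ i, ∀ z ∈ B.cocycles i j, ι z ∈ C.cocycles i j := fun i z hz => by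
    rw [hι, hcoc]
    exact ⟨⟨map_zero _, by rw [map_zero, LinearMap.mem_ker.mp hz.1]⟩, zero_mem _, hz.2⟩
  have hψ' : ∀ i, ∀ u ∈ B.chain (i - 1) j, ∃ u' ∈ C.chain (i - 1) j, C.d u' = ι (B.d u) :=
    fun i u hu => ⟨ι u, (hsc _ _ _).mpr ⟨zero_mem _, hu⟩, by
      rw [hι, hι, hs, map_zero, map_zero, zero_add]⟩
  let π : C.Chain →ₗ[ZMod 2] A.Chain := LinearMap.fst (ZMod 2) _ _ ∘ₗ e.toLinearMap
  have hπ : ∀ x y, π (e.symm (x, y)) = x := fun x y =>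
    congrArg Prod.fst (LinearEquiv.apply_symm_apply e (x, y))
  have hδ : ∀ i, ∀ z ∈ C.cocycles i j, π z ∈ A.cocycles (i + 1) j := fun i z hz => by
    obtain ⟨⟨x, y⟩, rfl⟩ := e.symm.surjective z
    rw [hcoc] at hz
    rw [hπ]
    exact ⟨hz.1.1, hz.2.1⟩
  have hδ' : ∀ i, ∀ u ∈ C.chain (i - 1) j,
      ∃ u' ∈ A.chain (i + 1 - 1) j, A.d u' = π (C.d u) := fun i u hu => by
    obtain ⟨⟨x, y⟩, rfl⟩ := e.symm.surjective u
    rw [hsc, sub_add_cancel] at hu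
    rw [hs, hπ, add_sub_cancel_right]
    exact ⟨x, hu.1, rfl⟩
  refine ⟨fun i => mapKh Φ (hφ i) (hφ' i), fun i => mapKh ι (hψ i) (hψ' i),
    fun i => mapKh π (hδ i) (hδ' i), fun i z w hw => ?_, fun i c => ?_, fun i c => ?_,
    fun i c => ?_⟩
  · rw [mapKh_homologyClass]
    exact congrArg homologyClass (Subtype.ext hw.symm)
  · obtain ⟨⟨y, hy⟩, rfl⟩ := homologyClass_surjective c
    rw [mapKh_homologyClass, homologyClass_eq_zero_iff]
    constructor
    · rintro ⟨u, hu, hdu⟩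
      obtain ⟨⟨x, y'⟩, rfl⟩ := e.symm.surjective u
      rw [hsc, sub_add_cancel] at hu
      dsimp only at hdu
      rw [hs, hι, e.symm.injective.eq_iff, Prod.mk.injEq] at hdu
      -- That `(x, y')` bounds `(0, y)` means `d x = 0` and `Φ x + d y' = y`, so `y` is homologous
      -- to `Φ x`.
      refine ⟨homologyClass ⟨x, hdu.1, hu.1⟩, ?_⟩
      rw [mapKh_homologyClass, homologyClass_eq_iff]
      refine ⟨y', hu.2, ?_⟩
      dsimp only
      rw [← hdu.2, Chain.sub_eq_add, ← add_assoc, Chain.add_self, zero_add]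
    · rintro ⟨c, hc⟩
      obtain ⟨⟨x, hx⟩, rfl⟩ := homologyClass_surjective c
      rw [mapKh_homologyClass, homologyClass_eq_iff] at hc
      obtain ⟨u, hu, hdu⟩ := hc
      refine ⟨e.symm (x, u), (hsc _ _ _).mpr ⟨by rw [sub_add_cancel]; exact hx.2, hu⟩, ?_⟩
      dsimp only at hdu ⊢
      rw [hs, hdu, hι, LinearMap.mem_ker.mp hx.1, Chain.sub_eq_add, ← add_assoc, Chain.add_self,
        zero_add]
  · obtain ⟨⟨z, hz⟩, rfl⟩ := homologyClass_surjective c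
    obtain ⟨⟨x, y⟩, rfl⟩ := e.symm.surjective z
    rw [mapKh_homologyClass, homologyClass_eq_zero_iff]
    have hz' := (hcoc i x y).mp hz
    constructor
    · rintro ⟨u, hu, hdu⟩
      dsimp only at hdu
      rw [hπ] at hdu
      rw [add_sub_cancel_right] at hu
      -- As `x = d u`, adding the boundary `d (u, 0) = (x, Φ u)` to `(x, y)` leaves `(0, y + Φ u)`.
      have hyu : y + Φ u ∈ B.cocycles i j := by
        refine ⟨LinearMap.mem_ker.mpr ?_, add_mem hz'.2.2 (hΦc i j u hu)⟩
        rw [map_add, ← hΦ, hdu, hz'.1.2, Chain.add_self]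
      refine ⟨homologyClass ⟨y + Φ u, hyu⟩, ?_⟩
      rw [mapKh_homologyClass, homologyClass_eq_iff]
      refine ⟨e.symm (u, 0), (hsc _ _ _).mpr ⟨by rwa [sub_add_cancel], zero_mem _⟩, ?_⟩
      dsimp only
      rw [hs, hι, hdu, Chain.sub_eq_add, ← map_add, Prod.mk_add_mk, zero_add, map_zero,
        add_zero, add_right_comm, Chain.add_self, zero_add]
    · rintro ⟨c, hc⟩
      obtain ⟨⟨y', hy'⟩, rfl⟩ := homologyClass_surjective c
      rw [mapKh_homologyClass, homologyClass_eq_iff] at hc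
      obtain ⟨u, hu, hdu⟩ := hc
      obtain ⟨⟨x'', y''⟩, rfl⟩ := e.symm.surjective u
      rw [hsc, sub_add_cancel] at hu
      dsimp only at hdu ⊢
      rw [hs, hι, ← map_sub, e.symm.injective.eq_iff, Prod.mk_sub_mk, Prod.mk.injEq,
        Chain.sub_eq_add, zero_add] at hdu
      exact ⟨x'', by rw [add_sub_cancel_right]; exact hu.1, by rw [hπ, hdu.1]⟩
  · obtain ⟨⟨x, hx⟩, rfl⟩ := homologyClass_surjective c
    rw [mapKh_homologyClass, homologyClass_eq_zero_iff]
    constructor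
    · rintro ⟨y, hy, hdy⟩
      rw [add_sub_cancel_right] at hy
      -- A chain `y` with `d y = Φ x` is exactly what completes `x` to a cocycle `(x, y)` of the
      -- cone.
      refine ⟨homologyClass ⟨e.symm (x, y), (hcoc _ _ _).mpr ⟨⟨hx.1, hdy.symm⟩, hx.2, hy⟩⟩, ?_⟩
      rw [mapKh_homologyClass]
      exact congrArg homologyClass (Subtype.ext (hπ x y))
    · rintro ⟨c, hc⟩
      obtain ⟨⟨z, hz⟩, rfl⟩ := homologyClass_surjective c
      obtain ⟨⟨x', y'⟩, rfl⟩ := e.symm.surjective z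
      have hz' := (hcoc i x' y').mp hz
      rw [mapKh_homologyClass, homologyClass_eq_iff] at hc
      obtain ⟨u, hu, hdu⟩ := hc
      dsimp only at hdu ⊢
      rw [hπ] at hdu
      -- Here `x = x' + d u` and `Φ x' = d y'`, hence `Φ x = d (y' + Φ u)`.
      refine ⟨y' + Φ u, add_mem ?_ (hΦc _ j u hu), ?_⟩
      · rw [add_sub_cancel_right]; exact hz'.2.2
      · rw [map_add, ← hz'.1.2, ← hΦ, hdu, ← map_add, Chain.sub_eq_add, ← add_assoc, Chain.add_self,
          zero_add]

end LongExact

end SingularLinkDiagram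

end

theorem mainTheorem2 {V : Type*} [Fintype V] [DecidableEq V] (D : SingularLinkDiagram V) (b : V)
    (hb : D.kind b = VertexKind.double) :
    -- the Khovanov complexes are complexes
    (D.IsComplex ∧ (D.resolve b VertexKind.negative).IsComplex ∧
      (D.resolve b VertexKind.positive).IsComplex) ∧
    -- the genus-one map is a chain map of bidegree `(0, 0)`
    (D.genusMap b ∘ₗ (D.resolve b VertexKind.negative).d =
        (D.resolve b VertexKind.positive).d ∘ₗ D.genusMap b ∧
      ∀ i j : ℤ, ((D.resolve b VertexKind.negative).chain i j).map (D.genusMap b) ≤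
        (D.resolve b VertexKind.positive).chain i j) ∧
    -- the long exact sequence
    ∀ j : ℤ,
      ∃ (φ : ∀ i : ℤ, (D.resolve b VertexKind.negative).Kh i j →ₗ[ZMod 2]
            (D.resolve b VertexKind.positive).Kh i j)
        (ψ : ∀ i : ℤ, (D.resolve b VertexKind.positive).Kh i j →ₗ[ZMod 2] D.Kh i j)
        (δ : ∀ i : ℤ, D.Kh i j →ₗ[ZMod 2] (D.resolve b VertexKind.negative).Kh (i + 1) j),
        (∀ (i : ℤ) (z : (D.resolve b VertexKind.negative).cocycles i j)
            (w : (D.resolve b VertexKind.positive).cocycles i j),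
            (w : (D.resolve b VertexKind.positive).Chain) = D.genusMap b z →
            φ i (SingularLinkDiagram.homologyClass z) = SingularLinkDiagram.homologyClass w) ∧
        (∀ i : ℤ, Function.Exact (φ i) (ψ i)) ∧
        (∀ i : ℤ, Function.Exact (ψ i) (δ i)) ∧
        (∀ i : ℤ, Function.Exact (δ i) (φ (i + 1))) := by
  refine ⟨⟨D.isComplex, SingularLinkDiagram.isComplex _, SingularLinkDiagram.isComplex _⟩,
    ⟨SingularLinkDiagram.genusMap_comp_d hb, fun i j => ?_⟩, fun j => ?_⟩
  · exact Submodule.map_le_iff_le_comap.mpr fun _ =>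
      SingularLinkDiagram.genusMap_mem_chain hb
  · exact SingularLinkDiagram.exists_longExact_of_cone (D.genusMap b)
      (LinearMap.congr_fun (SingularLinkDiagram.genusMap_comp_d hb))
      (fun _ _ _ => SingularLinkDiagram.genusMap_mem_chain hb)
      (SingularLinkDiagram.chainEquiv hb) (SingularLinkDiagram.chainEquiv_d hb)
      (fun _ _ => SingularLinkDiagram.mem_chain_iff_chainEquiv hb) j
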